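/- Let $k,r$ be non-negative integers and let $b_1,b_2,b_3:\mathbb R^k\to\mathbb R$ satisfy: $b_1,b_2\in L^\infty(\mathbb R^k)$, $b_3\in C^{r+1}(\mathbb R^k)$, and for some constant $C_0$ $$\max_{|\beta|=r+1}|D^\beta b_3(x)|\le C_0\sqrt{\sum_{|\alpha|\le r}|D^\alpha b_3(x)|^2+1}\qquad\text{for all }x\in\mathbb R^k .$$ Put $\mathbf b=(b_1,b_2,b_3)$. Let $\mathcal B_1$ be the operator $-\Delta+\mathbf b\times$ in $L^2(\mathbb R^k,\mathbb C^3)$, and let $-\Delta$ and $-\Delta\pm ib_3$ be the corresponding operators in $L^2(\mathbb R^k,\mathbb C)$; each of them is the closure (under the graph norm) of the differential operator defined on $C_0^\infty$. Let $\mathbb R_+=[0,\infty)$ and $$\Omega=\mathbb C\setminus\bigl(\mathbb R_+\cup\sigma(-\Delta+ib_3)\cup\sigma(-\Delta-ib_3)\bigr).$$ For $\lambda\in\Omega$ put $R_\pm(\lambda)=(-\Delta\pm ib_3-\lambda)^{-1}$, $c=(b_1+ib_2)/\sqrt2$, and define the bounded operator on $L^2(\mathbb R^k,\mathbb C)$ $$K_\lambda=(-\Delta-\lambda)^{-1}\bigl(c\,R_-(\lambda)\,\bar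 c+\bar c\,R_+(\lambda)\,c\bigr),$$ where $c$ and $\bar c$ act by multiplication. Then: 1. For every $\lambda\in\Omega$, $\lambda\in\sigma(\mathcal B_1)$ if and only if $-1\in\sigma(K_\lambda)$. 2. If $-\Delta+ib_3$ and $-\Delta-ib_3$ have compact resolvent, then every $\lambda\in\Omega\cap\sigma(\mathcal B_1)$ is an eigenvalue of $\mathcal B_1$, is an isolated point of $\sigma(\mathcal B_1)$, and has finite algebraic multiplicity, i.e. the spectral (Riesz) projection $-\frac1{2\pi i}\oint_{|w-\lambda|=\rho}(\mathcal B_1-w)^{-1}\,dw$, for a small radius $\rho>0$, has finite rank. -/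

import Mathlib

open MeasureTheory
open scoped ENNReal ContDiff Laplacian

noncomputable section

/-! ### Unbounded operators: resolvent, spectrum, eigenvalues -/

namespace LinearPMap

variable {H : Type*} [NormedAddCommGroup H] [NormedSpace ℂ H]

/-- `R` is the bounded two-sided inverse `(A - z)⁻¹` of `A - z : D(A) → H`. -/
structure IsResolventAt (A : H →ₗ.[ℂ] H) (z : ℂ) (R : H →L[ℂ] H) : Prop where
  right_inv : ∀ f : H, ∃ h : R f ∈ A.domain, A ⟨R f, h⟩ - z • R f = f
  left_inv : ∀ u : A.domain, R (A u - z • (u : H)) = u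

/-- The resolvent set of the (unbounded) operator `A`. -/
def resolventSet (A : H →ₗ.[ℂ] H) : Set ℂ := {z | ∃ R : H →L[ℂ] H, A.IsResolventAt z R}

/-- The spectrum of the (unbounded) operator `A`. -/
def spectrum (A : H →ₗ.[ℂ] H) : Set ℂ := A.resolventSetᶜ

open Classical in
/-- The resolvent `(A - z)⁻¹`; it is set to `0` when `z` is in the spectrum of `A`. -/
def resolvent (A : H →ₗ.[ℂ] H) (z : ℂ) : H →L[ℂ] H :=
  if h : z ∈ A.resolventSet then h.choose else 0

/-- `A` has compact resolvent: `(A - z)⁻¹` is compact for some `z` in the resolvent set. -/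
def HasCompactResolvent (A : H →ₗ.[ℂ] H) : Prop :=
  ∃ z ∈ A.resolventSet, IsCompactOperator (A.resolvent z)

/-- `z` is an eigenvalue of `A`. -/
def HasEigenvalue (A : H →ₗ.[ℂ] H) (z : ℂ) : Prop :=
  ∃ u : A.domain, u ≠ 0 ∧ A u = z • (u : H)

/-- `-(2πi)⁻¹ ∮_{|w - z| = ρ} (A - w)⁻¹ dw`, the spectral (Riesz) projection of `A` at `z` when
the closed disc of radius `ρ` about `z` meets the spectrum at most at `z`. -/
def rieszProjection (A : H →ₗ.[ℂ] H) (z : ℂ) (ρ : ℝ) : H →L[ℂ] H :=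
  -(2 * Real.pi * Complex.I : ℂ)⁻¹ • circleIntegral (fun w => A.resolvent w) z ρ

/-- `z` is an eigenvalue of `A`, an isolated point of its spectrum, and its algebraic multiplicity
(the rank of the spectral projection) is finite. -/
def IsIsolatedEigenvalueOfFiniteMultiplicity (A : H →ₗ.[ℂ] H) (z : ℂ) : Prop :=
  A.HasEigenvalue z ∧
    ∃ ρ : ℝ, 0 < ρ ∧ (∀ w ∈ Metric.closedBall z ρ, w ≠ z → w ∈ A.resolventSet) ∧
      FiniteDimensional ℂ (A.rieszProjection z ρ).range

end LinearPMap

namespace BlochTorrey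

/-- The space `ℝᵏ`. -/
abbrev Space (k : ℕ) : Type := EuclideanSpace ℝ (Fin k)

/-- The Hilbert space `L²(ℝᵏ, F)`. -/
abbrev L2 (k : ℕ) (F : Type*) [NormedAddCommGroup F] : Type _ :=
  Lp F 2 (volume : Measure (Space k))

/-! ### Schrödinger operators with matrix potentials -/

section Schrodinger

variable {k : ℕ} {F : Type*} [NormedAddCommGroup F] [NormedSpace ℝ F] [NormedSpace ℂ F]

theorem two_le_smooth : (2 : WithTop ℕ∞) ≤ ((⊤ : ℕ∞) : WithTop ℕ∞) := by
  exact WithTop.coe_le_coe.2 (le_top : (2 : ℕ∞) ≤ ⊤)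

/-- The graph of `-Δ + V` on `C₀^∞(ℝᵏ, F)`, in `L² × L²`. -/
def testGraph (V : Space k → F →ₗ[ℂ] F) : Submodule ℂ (L2 k F × L2 k F) where
  carrier := {p | ∃ u : Space k → F, ContDiff ℝ ∞ u ∧ HasCompactSupport u ∧
    p.1 =ᵐ[volume] u ∧ p.2 =ᵐ[volume] fun x => -(Δ u) x + V x (u x)}
  zero_mem' := by
    refine ⟨fun _ => 0, contDiff_const, HasCompactSupport.zero, Lp.coeFn_zero _ _ _, ?_⟩
    filter_upwards [Lp.coeFn_zero F 2 (volume : Measure (Space k))] with x hx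
    rw [Prod.snd_zero, hx]
    simp
  add_mem' := by
    rintro p q ⟨u, hu, hu', h1, h2⟩ ⟨v, hv, hv', h3, h4⟩
    refine ⟨u + v, hu.add hv, hu'.add hv', ?_, ?_⟩
    · filter_upwards [Lp.coeFn_add p.1 q.1, h1, h3] with x hx h1 h3
      rw [Prod.fst_add, hx, Pi.add_apply, Pi.add_apply, h1, h3]
    · filter_upwards [Lp.coeFn_add p.2 q.2, h2, h4] with x hx h2 h4
      have h2u : ContDiffAt ℝ 2 u x := hu.contDiffAt.of_le two_le_smooth
      have h2v : ContDiffAt ℝ 2 v x := hv.contDiffAt.of_le two_le_smooth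
      simp only [Prod.snd_add, hx, Pi.add_apply, h2, h4, h2u.laplacian_add h2v, map_add]
      abel
  smul_mem' := by
    rintro a p ⟨u, hu, hu', h1, h2⟩
    refine ⟨a • u, contDiff_const.smul hu, hu'.smul_left (f := fun _ => a), ?_, ?_⟩
    · filter_upwards [Lp.coeFn_smul a p.1, h1] with x hx h1
      rw [Prod.smul_fst, hx, Pi.smul_apply, Pi.smul_apply, h1]
    · filter_upwards [Lp.coeFn_smul a p.2, h2] with x hx h2
      have h2u : ContDiffAt ℝ 2 u x := hu.contDiffAt.of_le two_le_smooth
      simp only [Prod.smul_snd, hx, Pi.smul_apply, h2, InnerProductSpace.laplacian_smul a h2u,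
        map_smul, smul_add, smul_neg]

/-- `testGraph V` is the graph of an operator: the class in `L²` determines the test function. -/
theorem testGraph_single_valued (V : Space k → F →ₗ[ℂ] F) (p : L2 k F × L2 k F)
    (hp : p ∈ testGraph V) (h0 : p.1 = 0) : p.2 = 0 := by
  obtain ⟨u, hu, -, h1, h2⟩ := hp
  have hu0 : u = fun _ => 0 := by
    refine (Continuous.ae_eq_iff_eq volume hu.continuous continuous_const).1 ?_
    rw [h0] at h1
    exact h1.symm.trans (Lp.coeFn_zero F 2 volume)
  refine Lp.ext (h2.trans ?_)
  refine Filter.EventuallyEq.trans ?_ (Lp.coeFn_zero F 2 volume).symm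
  filter_upwards with x
  simp [hu0]

/-- `-Δ + V` as an unbounded operator in `L²(ℝᵏ, F)`: the closure, under the graph norm, of the
operator defined on `C₀^∞(ℝᵏ, F)`. -/
def schrodinger (V : Space k → F →ₗ[ℂ] F) : L2 k F →ₗ.[ℂ] L2 k F :=
  (testGraph V).toLinearPMap.closure

end Schrodinger

/-- `-Δ + q` in `L²(ℝᵏ, ℂ)`, with a complex scalar potential `q`. -/
def scalarOp {k : ℕ} (q : Space k → ℂ) : L2 k ℂ →ₗ.[ℂ] L2 k ℂ :=
  schrodinger fun x => LinearMap.mulLeft ℂ (q x)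

/-- The linear map `u ↦ b × u` on `ℂ³`, for `b ∈ ℝ³`. -/
def crossMap (b : Fin 3 → ℝ) : EuclideanSpace ℂ (Fin 3) →ₗ[ℂ] EuclideanSpace ℂ (Fin 3) :=
  (WithLp.linearEquiv 2 ℂ (Fin 3 → ℂ)).symm.toLinearMap ∘ₗ
    crossProduct (fun j => (b j : ℂ)) ∘ₗ (WithLp.linearEquiv 2 ℂ (Fin 3 → ℂ)).toLinearMap

/-- The operator `-Δ + b ×` in `L²(ℝᵏ, ℂ³)`, with `b = (b₁, b₂, b₃)`. -/
def blochTorrey {k : ℕ} (b₁ b₂ b₃ : Space k → ℝ) :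
    L2 k (EuclideanSpace ℂ (Fin 3)) →ₗ.[ℂ] L2 k (EuclideanSpace ℂ (Fin 3)) :=
  schrodinger fun x => crossMap ![b₁ x, b₂ x, b₃ x]

/-- The operator `-Δ + i b₃` in `L²(ℝᵏ, ℂ)`. -/
def opPlus {k : ℕ} (b₃ : Space k → ℝ) : L2 k ℂ →ₗ.[ℂ] L2 k ℂ :=
  scalarOp fun x => Complex.I * b₃ x

/-- The operator `-Δ - i b₃` in `L²(ℝᵏ, ℂ)`. -/
def opMinus {k : ℕ} (b₃ : Space k → ℝ) : L2 k ℂ →ₗ.[ℂ] L2 k ℂ :=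
  scalarOp fun x => -(Complex.I * b₃ x)

/-- `Ω = ℂ \ ([0, ∞) ∪ σ(-Δ + i b₃) ∪ σ(-Δ - i b₃))`. -/
def Omega {k : ℕ} (b₃ : Space k → ℝ) : Set ℂ :=
  ((Complex.ofReal '' Set.Ici 0) ∪ (opPlus b₃).spectrum ∪ (opMinus b₃).spectrum)ᶜ

/-! ### The operator `K_z` -/

/-- Multiplication by `c ∈ L^∞(ℝᵏ, ℂ)` as a bounded operator on `L²(ℝᵏ, ℂ)`. -/
def mulOp {k : ℕ} (c : Space k → ℂ) (hc : MemLp c ∞ volume) : L2 k ℂ →L[ℂ] L2 k ℂ :=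
  (ContinuousLinearMap.mul ℂ ℂ).holderL volume ∞ 2 2 (hc.toLp c)

/-- `c = (b₁ + i b₂) / √2`. -/
def cField {k : ℕ} (b₁ b₂ : Space k → ℝ) (x : Space k) : ℂ :=
  (b₁ x + Complex.I * b₂ x) / (Real.sqrt 2 : ℂ)

theorem memLp_cField {k : ℕ} {b₁ b₂ : Space k → ℝ} (h₁ : MemLp b₁ ∞ volume)
    (h₂ : MemLp b₂ ∞ volume) : MemLp (cField b₁ b₂) ∞ volume := by
  have h : MemLp (fun x => (Real.sqrt 2 : ℂ)⁻¹ * ((b₁ x : ℂ) + Complex.I * (b₂ x : ℂ))) ∞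
      (volume : Measure (Space k)) :=
    ((h₁.ofReal (K := ℂ)).add ((h₂.ofReal (K := ℂ)).const_mul Complex.I)).const_mul _
  refine h.ae_eq (Filter.Eventually.of_forall fun x => ?_)
  simp [cField, div_eq_inv_mul]

theorem memLp_conj_cField {k : ℕ} {b₁ b₂ : Space k → ℝ} (h₁ : MemLp b₁ ∞ volume)
    (h₂ : MemLp b₂ ∞ volume) :
    MemLp (fun x => starRingEnd ℂ (cField b₁ b₂ x)) ∞ volume :=
  (memLp_cField h₁ h₂).star

/-- `K_z = (-Δ - z)⁻¹ (c R₋(z) c̄ + c̄ R₊(z) c)`, where `R_±(z) = (-Δ ± i b₃ - z)⁻¹`. -/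
def schurK {k : ℕ} {b₁ b₂ : Space k → ℝ} (h₁ : MemLp b₁ ∞ volume) (h₂ : MemLp b₂ ∞ volume)
    (b₃ : Space k → ℝ) (z : ℂ) : L2 k ℂ →L[ℂ] L2 k ℂ :=
  let c := mulOp (cField b₁ b₂) (memLp_cField h₁ h₂)
  let cbar := mulOp (fun x => starRingEnd ℂ (cField b₁ b₂ x)) (memLp_conj_cField h₁ h₂)
  (scalarOp fun _ => 0).resolvent z ∘L
    (c ∘L (opMinus b₃).resolvent z ∘L cbar + cbar ∘L (opPlus b₃).resolvent z ∘L c)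

/-! ### The growth condition on `b₃` -/

/-- The partial derivative `D^α f = ∂₁^{α₁} ⋯ ∂ₖ^{αₖ} f`. -/
def partialDeriv {k : ℕ} (α : Fin k → ℕ) (f : Space k → ℝ) : Space k → ℝ :=
  (List.finRange k).foldr
    (fun i g => (fun h x => fderiv ℝ h x (EuclideanSpace.single i 1))^[α i] g) f

/-- `max_{|β| = r+1} |D^β f(x)| ≤ C √(∑_{|α| ≤ r} |D^α f(x)|² + 1)` for all `x`. -/
def GrowthCondition {k : ℕ} (r : ℕ) (C : ℝ) (f : Space k → ℝ) : Prop :=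
  ∀ x, ∀ β ∈ Finset.piAntidiag (Finset.univ : Finset (Fin k)) (r + 1),
    |partialDeriv β f x| ≤
      C * Real.sqrt (∑ n ∈ Finset.range (r + 1),
        ∑ α ∈ Finset.piAntidiag (Finset.univ : Finset (Fin k)) n, |partialDeriv α f x| ^ 2 + 1)

end BlochTorrey

end

open BlochTorrey

/-! ### Resolvents of unbounded operators, described through graphs -/

noncomputable section

namespace LinearPMap

open Filter Topology

variable {H : Type*} [NormedAddCommGroup H] [NormedSpace ℂ H]

/-! In the basis `(1, -i, 0)/√2`, `(1, i, 0)/√2`, `(0, 0, 1)` the potential becomes a 3×3 matrix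
with diagonal `i b₃`, `-i b₃`, `0`, whose only other entries are bounded multiplications by
multiples of `c` and `c̄` coupling the third component to the first two. Bounded couplings do not
affect graph closures, so the closed operator splits in the same way; `CoupledSystem` records this
abstractly. Eliminating the first two components leaves the Schur complement `1 + K_z` on the third,
which gives part 1 (`mem_resolventSet_iff`).

For part 2, freeze compact resolvents `R₁`, `R₂` of the first two blocks at fixed points and let
only the free resolvent `R₃(w)` vary. Then `(A - w) diag(R₁, R₂, R₃(w)) = (1 + N(w))(1 + G(w))` with
`N(w)² = 0` and `G(w)` compact and analytic on the whole of `ℂ \ [0, ∞)`. This set is connected even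
when `Ω` is not. Near each point, `exists_local_inverse` supplies an analytic scalar `d` and an
analytic operator `Y` with `(1 + G) Y = Y (1 + G) = d`, so noninvertibility is either locally
identical or isolated. Accretivity of the three blocks excludes an eigenvalue at some `-t < 0`, and
connectedness then excludes the first alternative everywhere. Hence the resolvent of `A` has at most
a pole at each spectral point outside `[0, ∞)`, the eigenspace there is finite-dimensional, and a
descending induction on the moments of the resolvent bounds the rank of the Riesz projection.

Resolvents are handled through `isResolventAt_iff`, which turns membership in the graph into one
vector equation without domain conditions. -/

theorem isResolventAt_iff {A : H →ₗ.[ℂ] H} {z : ℂ} {R : H →L[ℂ] H} :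
    A.IsResolventAt z R ↔ ∀ u g : H, (u, g) ∈ A.graph ↔ R (g - z • u) = u := by
  constructor
  · intro h u g
    constructor
    · intro hu
      obtain ⟨v, rfl, rfl⟩ := A.mem_graph_iff.1 hu
      exact h.left_inv v
    · intro hu
      obtain ⟨hd, h'⟩ := h.right_inv (g - z • u)
      rw [mem_graph_iff]
      refine ⟨⟨R (g - z • u), hd⟩, hu, ?_⟩
      rw [sub_eq_iff_eq_add] at h'
      rw [h', hu, sub_add_cancel]
  · intro h
    refine ⟨fun f => ?_, fun u => (h u (A u)).1 (A.mem_graph u)⟩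
    have h1 : (R f, f + z • R f) ∈ A.graph := by
      rw [h, add_sub_cancel_right]
    obtain ⟨v, hv, hv'⟩ := A.mem_graph_iff.1 h1
    simp only at hv hv'
    have hd : R f ∈ A.domain := hv ▸ v.2
    refine ⟨hd, ?_⟩
    have : v = ⟨R f, hd⟩ := Subtype.ext hv
    rw [← this, hv', add_sub_cancel_right]

theorem IsResolventAt.unique {A : H →ₗ.[ℂ] H} {z : ℂ} {R S : H →L[ℂ] H}
    (hR : A.IsResolventAt z R) (hS : A.IsResolventAt z S) : R = S := by
  rw [isResolventAt_iff] at hR hS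
  ext f
  have h : (S f, f + z • S f) ∈ A.graph := by rw [hS, add_sub_cancel_right]
  rw [hR, add_sub_cancel_right] at h
  exact h

theorem resolvent_spec {A : H →ₗ.[ℂ] H} {z : ℂ} (h : z ∈ A.resolventSet) :
    A.IsResolventAt z (A.resolvent z) := by
  rw [resolvent, dif_pos h]
  exact h.choose_spec

theorem IsResolventAt.resolvent_eq {A : H →ₗ.[ℂ] H} {z : ℂ} {R : H →L[ℂ] H}
    (hR : A.IsResolventAt z R) : A.resolvent z = R :=
  (resolvent_spec ⟨R, hR⟩).unique hR

theorem IsResolventAt.isClosed {A : H →ₗ.[ℂ] H} {z : ℂ} {R : H →L[ℂ] H}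
    (hR : A.IsResolventAt z R) : A.IsClosed := by
  have h : (A.graph : Set (H × H)) = {p | R (p.2 - z • p.1) = p.1} := by
    ext p
    exact isResolventAt_iff.1 hR p.1 p.2
  rw [LinearPMap.IsClosed, h]
  exact isClosed_eq (by fun_prop) continuous_fst

/-- The closure is `A` itself when `A` is not closable, so it cannot have a resolvent then. -/
theorem isClosable_of_mem_resolventSet_closure {A : H →ₗ.[ℂ] H} {z : ℂ}
    (h : z ∈ A.closure.resolventSet) : A.IsClosable := by
  by_contra hA
  obtain ⟨R, hR⟩ := h
  rw [closure_def' hA] at hR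
  exact hA hR.isClosed.isClosable

/-- The first resolvent identity. -/
theorem IsResolventAt.eq_add {A : H →ₗ.[ℂ] H} {z w : ℂ} {R S : H →L[ℂ] H}
    (hR : A.IsResolventAt z R) (hS : A.IsResolventAt w S) : S = R + (w - z) • (R * S) := by
  rw [isResolventAt_iff] at hR hS
  ext f
  have h : (S f, f + w • S f) ∈ A.graph := by rw [hS, add_sub_cancel_right]
  rw [hR, add_sub_assoc, ← sub_smul, _root_.map_add, _root_.map_smul] at h
  exact h.symm

/-- The graph equation `R (g - z u) = u` is the same as `R (g - w u) = (1 - (w - z) R) u`. -/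
theorem IsResolventAt.of_isUnit {A : H →ₗ.[ℂ] H} {z w : ℂ} {R : H →L[ℂ] H}
    (hR : A.IsResolventAt z R) (hu : IsUnit (1 - (w - z) • R)) :
    A.IsResolventAt w (Ring.inverse (1 - (w - z) • R) * R) := by
  rw [isResolventAt_iff] at hR ⊢
  intro u g
  have e1 : R (g - z • u) = R (g - w • u) + (w - z) • R u := by
    simp only [_root_.map_sub, _root_.map_smul]
    module
  rw [hR, e1]
  set X := (1 : H →L[ℂ] H) - (w - z) • R with hX
  constructor
  · intro h
    have : R (g - w • u) = X u := by
      simp only [hX, _root_.sub_apply, one_apply_eq_self,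
        _root_.smul_apply]
      rw [eq_sub_iff_add_eq, h]
    rw [mul_apply_eq_comp, this, ← mul_apply_eq_comp,
      Ring.inverse_mul_cancel _ hu, one_apply_eq_self]
  · intro h
    have : X u = R (g - w • u) := by
      conv_lhs => rw [← h]
      rw [← mul_apply_eq_comp, ← mul_assoc, Ring.mul_inverse_cancel _ hu, one_mul]
    simp only [hX, _root_.sub_apply, one_apply_eq_self,
        _root_.smul_apply] at this
    rw [← this, sub_add_cancel]

theorem eventually_isResolventAt [CompleteSpace H] {A : H →ₗ.[ℂ] H} {z : ℂ} {R : H →L[ℂ] H}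
    (hR : A.IsResolventAt z R) :
    ∀ᶠ w in 𝓝 z, A.IsResolventAt w (Ring.inverse (1 - (w - z) • R) * R) := by
  have hc : Continuous fun w : ℂ => (1 : H →L[ℂ] H) - (w - z) • R := by fun_prop
  have h1 : IsUnit ((1 : H →L[ℂ] H) - (z - z) • R) := by simp
  filter_upwards [hc.continuousAt.preimage_mem_nhds (Units.isOpen.mem_nhds h1)] with w hw
  exact hR.of_isUnit hw

theorem differentiableAt_resolvent [CompleteSpace H] {A : H →ₗ.[ℂ] H} {z : ℂ}
    (hz : z ∈ A.resolventSet) : DifferentiableAt ℂ A.resolvent z := by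
  have hR := resolvent_spec hz
  set R := A.resolvent z with hRdef
  have h : A.resolvent =ᶠ[𝓝 z] fun w => Ring.inverse (1 - (w - z) • R) * R := by
    filter_upwards [eventually_isResolventAt hR] with w hw using hw.resolvent_eq
  refine DifferentiableAt.congr_of_eventuallyEq ?_ h
  refine DifferentiableAt.mul_const ?_ R
  have h1 : IsUnit ((1 : H →L[ℂ] H) - (z - z) • R) := by simp
  have h2 : DifferentiableAt ℂ (fun w : ℂ => (1 : H →L[ℂ] H) - (w - z) • R) z := by fun_prop
  exact (differentiableAt_inverse (𝕜 := ℂ) h1).comp z h2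

/-! ### Finite rank of the Riesz projection at a pole -/

/-- `T` maps the range of `P` onto a finite-dimensional space, and the part it kills lies in `ker
T`. -/
theorem finiteDimensional_range_of_mul {E : Type*} [AddCommGroup E] [Module ℂ E]
    (T P : E →ₗ[ℂ] E) (hT : FiniteDimensional ℂ (LinearMap.ker T))
    (h : FiniteDimensional ℂ (LinearMap.range (T ∘ₗ P))) :
    FiniteDimensional ℂ (LinearMap.range P) := by
  rw [← Submodule.fg_iff_finiteDimensional] at *
  refine Submodule.fg_of_fg_map_of_fg_inf_ker T ?_ ?_
  · rwa [LinearMap.range_comp] at h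
  · rw [Submodule.fg_iff_finiteDimensional] at *
    exact Submodule.finiteDimensional_of_le (inf_le_right (a := LinearMap.range P))

theorem circleIntegral_mul_left {R : Type*} [NormedRing R] [NormedAlgebra ℂ R] [CompleteSpace R]
    (a : R) {f : ℂ → R} {c : ℂ} {r : ℝ} (hf : CircleIntegrable f c r) :
    (∮ w in C(c, r), a * f w) = a * ∮ w in C(c, r), f w := by
  have h := ContinuousLinearMap.intervalIntegral_comp_comm (ContinuousLinearMap.mul ℂ R a) hf.out
  simpa [circleIntegral] using h

/-- If the resolvent has at most a pole at `z` and the eigenspace at `z` is finite-dimensional, then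
the spectral projection at `z` has finite rank. -/
theorem finiteDimensional_range_rieszProjection [CompleteSpace H] {A : H →ₗ.[ℂ] H} {z : ℂ} {ρ : ℝ}
    (hρ : 0 < ρ) (hA : ∀ w ∈ Metric.sphere z ρ, w ∈ A.resolventSet)
    {N : Submodule ℂ H} [FiniteDimensional ℂ N] (hN : ∀ u, (u, z • u) ∈ A.graph → u ∈ N)
    {n : ℕ} (hn : (∮ w in C(z, ρ), (w - z) ^ n • A.resolvent w) = 0) :
    FiniteDimensional ℂ (A.rieszProjection z ρ).range := by
  have hcont : ContinuousOn A.resolvent (Metric.sphere z ρ) := fun w hw =>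
    (differentiableAt_resolvent (hA w hw)).continuousAt.continuousWithinAt
  have hint : ∀ j : ℕ, CircleIntegrable (fun w => (w - z) ^ j • A.resolvent w) z ρ := fun j =>
    ContinuousOn.circleIntegrable hρ.le (by fun_prop)
  set P : ℕ → H →L[ℂ] H := fun j => ∮ w in C(z, ρ), (w - z) ^ j • A.resolvent w with hP
  -- An auxiliary point on the circle, where the resolvent `S` exists; `z` itself may be spectral.
  set a : ℂ := z + ρ with ha
  have ha' : a ∈ Metric.sphere z ρ := by simp [ha, abs_of_pos hρ]
  set S := A.resolvent a with hS
  have hSr : A.IsResolventAt a S := resolvent_spec (hA a ha')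
  -- Integrate the resolvent identity between `a` and `w` against `(w - z)^j`, writing `w - a = (w -
  -- z) + (z - a)`; the constant term `S` drops out by Cauchy.
  have key : ∀ j, (1 - (z - a) • S) * P j = S * P (j + 1) := by
    intro j
    have e : P j = ∮ w in C(z, ρ), ((w - z) ^ j • S +
        S * ((w - z) ^ (j + 1) • A.resolvent w + (z - a) • ((w - z) ^ j • A.resolvent w))) := by
      refine circleIntegral.integral_congr hρ.le fun w hw => ?_
      have h := hSr.eq_add (resolvent_spec (hA w hw))
      conv_lhs => rw [h]
      simp only [mul_smul_comm, smul_add, smul_smul, ← add_smul]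
      congr 2
      ring
    have i1 : CircleIntegrable (fun w : ℂ => (w - z) ^ j • S) z ρ :=
      ContinuousOn.circleIntegrable hρ.le (by fun_prop)
    have i2 : CircleIntegrable (fun w : ℂ => (w - z) ^ (j + 1) • A.resolvent w +
        (z - a) • ((w - z) ^ j • A.resolvent w)) z ρ :=
      ContinuousOn.circleIntegrable hρ.le (by fun_prop)
    have i2' : CircleIntegrable (fun w : ℂ => S * ((w - z) ^ (j + 1) • A.resolvent w +
        (z - a) • ((w - z) ^ j • A.resolvent w))) z ρ :=
      ContinuousOn.circleIntegrable hρ.le (by fun_prop)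
    have i3 : CircleIntegrable (fun w : ℂ => (z - a) • ((w - z) ^ j • A.resolvent w)) z ρ :=
      ContinuousOn.circleIntegrable hρ.le (by fun_prop)
    have z1 : (∮ w in C(z, ρ), (w - z) ^ j • S) = 0 := by
      refine DiffContOnCl.circleIntegral_eq_zero hρ.le (Differentiable.diffContOnCl ?_)
      fun_prop
    rw [circleIntegral.integral_add i1 i2', z1, zero_add, circleIntegral_mul_left S i2,
      circleIntegral.integral_add (hint (j + 1)) i3, circleIntegral.integral_smul] at e
    rw [sub_mul, one_mul, sub_eq_iff_eq_add]
    conv_lhs => rw [e]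
    rw [mul_add, mul_smul_comm, smul_mul_assoc]
  -- A vector with `u = (z - a) S u` is an eigenvector of `A` at `z`, or zero.
  have hker : FiniteDimensional ℂ (LinearMap.ker (1 - (z - a) • S : H →L[ℂ] H).toLinearMap) := by
    refine Submodule.finiteDimensional_of_le (S₂ := N) fun u hu => hN u ?_
    rw [isResolventAt_iff.1 hSr, ← sub_smul, _root_.map_smul]
    have : u - (z - a) • S u = 0 := by simpa using hu
    exact (sub_eq_zero.1 this).symm
  -- Descend from `P n = 0` to `P 0`, which is the Riesz projection up to a scalar.
  have hfin : ∀ i, i ≤ n → FiniteDimensional ℂ (LinearMap.range (P (n - i)).toLinearMap) := by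
    intro i
    induction i with
    | zero =>
      intro _
      have : P (n - 0) = 0 := hn
      rw [this]
      have : (0 : H →L[ℂ] H).toLinearMap.range = ⊥ := by
        rw [ContinuousLinearMap.toLinearMap_zero, LinearMap.range_zero]
      rw [this]
      infer_instance
    | succ i ih =>
      intro hi
      have ih := ih (by omega)
      refine finiteDimensional_range_of_mul _ _ hker ?_
      have h := key (n - (i + 1))
      rw [show n - (i + 1) + 1 = n - i by omega] at h
      have h' : (1 - (z - a) • S : H →L[ℂ] H).toLinearMap ∘ₗ (P (n - (i + 1))).toLinearMap =
          S.toLinearMap ∘ₗ (P (n - i)).toLinearMap := by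
        ext x
        exact congrArg (fun T : H →L[ℂ] H => T x) h
      rw [h', LinearMap.range_comp]
      infer_instance
  have h0 := hfin n le_rfl
  rw [Nat.sub_self] at h0
  have hP0 : P 0 = circleIntegral (fun w => A.resolvent w) z ρ := by simp [hP]
  rw [hP0] at h0
  refine Submodule.finiteDimensional_of_le (S₂ := LinearMap.range
    (circleIntegral (fun w => A.resolvent w) z ρ).toLinearMap) ?_
  rintro _ ⟨x, rfl⟩
  refine ⟨-(2 * Real.pi * Complex.I : ℂ)⁻¹ • x, ?_⟩
  simp [rieszProjection]

end LinearPMap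

end

/-! ### The local analytic Fredholm theorem -/

noncomputable section

namespace FredholmTheory

open Filter Topology

/-- Take `V` spanned by the centres of finitely many `ε`-balls covering the image of the unit ball;
the orthogonal projection onto `V` is at least as close as any centre. -/
theorem exists_finiteDimensional_approx {E : Type*} [NormedAddCommGroup E] [InnerProductSpace ℂ E]
    [CompleteSpace E] {K : E →L[ℂ] E} (hK : IsCompactOperator K) {ε : ℝ} (hε : 0 < ε) :
    ∃ (V : Submodule ℂ E) (_ : FiniteDimensional ℂ V), ‖K - V.starProjection * K‖ ≤ ε := by
  have hc := hK.isCompact_closure_image_closedBall (1 : ℝ)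
  obtain ⟨t, -, ht, hcov⟩ := hc.finite_cover_balls hε
  have hfin : FiniteDimensional ℂ (Submodule.span ℂ t) := FiniteDimensional.span_of_finite ℂ ht
  refine ⟨Submodule.span ℂ t, hfin, ?_⟩
  refine ContinuousLinearMap.opNorm_le_of_unit_norm hε.le fun x hx => ?_
  have hmem : K x ∈ closure (K '' Metric.closedBall 0 1) :=
    subset_closure ⟨x, by simp [hx], rfl⟩
  obtain ⟨y, hy, hxy⟩ := Set.mem_iUnion₂.1 (hcov hmem)
  rw [Metric.mem_ball, dist_eq_norm] at hxy
  have h1 := Submodule.starProjection_minimal (U := Submodule.span ℂ t) (K x)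
  have h2 : ‖K x - (Submodule.span ℂ t).starProjection (K x)‖ ≤ ‖K x - y‖ := by
    rw [h1]
    exact ciInf_le ⟨0, by rintro _ ⟨v, rfl⟩; exact norm_nonneg _⟩
      (⟨y, Submodule.subset_span hy⟩ : Submodule.span ℂ t)
  simpa using h2.trans hxy.le

theorem differentiableAt_det {m : ℕ} {M : ℂ → Matrix (Fin m) (Fin m) ℂ} {z : ℂ}
    (h : ∀ i j, DifferentiableAt ℂ (fun w => M w i j) z) :
    DifferentiableAt ℂ (fun w => (M w).det) z := by
  simp only [Matrix.det_apply]
  refine DifferentiableAt.fun_sum fun σ _ => ?_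
  refine DifferentiableAt.const_smul ?_ _
  exact DifferentiableAt.fun_finsetProd fun i _ => h _ _

theorem differentiableAt_adjugate {m : ℕ} {M : ℂ → Matrix (Fin m) (Fin m) ℂ} {z : ℂ}
    (h : ∀ i j, DifferentiableAt ℂ (fun w => M w i j) z) (i j : Fin m) :
    DifferentiableAt ℂ (fun w => (M w).adjugate i j) z := by
  simp only [Matrix.adjugate_apply]
  refine differentiableAt_det fun i' j' => ?_
  simp only [Matrix.updateRow_apply]
  split_ifs
  · exact differentiableAt_const _
  · exact h _ _

variable {E : Type*} [NormedAddCommGroup E] [NormedSpace ℂ E]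

/-- The operator `1 + D K`, where `K = ∑ φⱼ ⊗ vⱼ` has finite rank, is inverted by Cramer's rule. -/
def cramerInverse {m : ℕ} (φ : Fin m → E →L[ℂ] ℂ) (v : Fin m → E)
    (D : E →L[ℂ] E) : E →L[ℂ] E :=
  let M : Matrix (Fin m) (Fin m) ℂ := 1 + Matrix.of fun i j => φ i (D (v j))
  M.det • 1 - D * ∑ i, ∑ j, M.adjugate i j • (φ j).smulRight (v i)

/-- Applying the `φ i` to `(1 + D K) x` gives `M` times the vector `(φ j x)`, so the adjugate
recovers `det M • K x`. Nothing is divided by, hence the identity survives where the determinant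
vanishes. -/
theorem cramerInverse_mul {m : ℕ} (φ : Fin m → E →L[ℂ] ℂ) (v : Fin m → E) (D : E →L[ℂ] E) :
    cramerInverse φ v D * (1 + D * ∑ j, (φ j).smulRight (v j)) =
      (1 + Matrix.of fun i j => φ i (D (v j))).det • 1 := by
  set M : Matrix (Fin m) (Fin m) ℂ := 1 + Matrix.of fun i j => φ i (D (v j)) with hM
  have key : (∑ i, ∑ j, M.adjugate i j • (φ j).smulRight (v i)) *
      (1 + D * ∑ j, (φ j).smulRight (v j)) = M.det • ∑ j, (φ j).smulRight (v j) := by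
    ext x
    have hMφ : ∀ i, φ i (x + D (∑ j, φ j x • v j)) = ∑ j, M i j * φ j x := by
      intro i
      simp [hM, Matrix.add_apply, add_mul, Finset.sum_add_distrib, Matrix.one_apply]
      exact Finset.sum_congr rfl fun _ _ => mul_comm _ _
    have h1 : ∀ i, ∑ j, M.adjugate i j * φ j (x + D (∑ j, φ j x • v j)) = M.det * φ i x := by
      intro i
      have := congrFun (congrArg (fun A : Matrix (Fin m) (Fin m) ℂ => A.mulVec fun j => φ j x)
        M.adjugate_mul) i
      simp only [← Matrix.mulVec_mulVec, Matrix.smul_mulVec, Matrix.one_mulVec, Pi.smul_apply,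
        smul_eq_mul] at this
      rw [← this]
      simp only [hMφ]
      rfl
    simp only [mul_apply_eq_comp, add_apply, one_apply_eq_self, sum_apply, smul_apply,
      ContinuousLinearMap.smulRight_apply, smul_smul, ← Finset.sum_smul, h1, Finset.smul_sum]
  rw [cramerInverse, sub_mul, mul_assoc, key, smul_mul_assoc, one_mul, smul_add, mul_smul_comm,
    add_sub_cancel_right]

theorem mul_cramerInverse {m : ℕ} (φ : Fin m → E →L[ℂ] ℂ) (v : Fin m → E) (D : E →L[ℂ] E) :
    (1 + D * ∑ j, (φ j).smulRight (v j)) * cramerInverse φ v D =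
      (1 + Matrix.of fun i j => φ i (D (v j))).det • 1 := by
  set M : Matrix (Fin m) (Fin m) ℂ := 1 + Matrix.of fun i j => φ i (D (v j)) with hM
  have key : (1 + (∑ j, (φ j).smulRight (v j)) * D) *
      (∑ i, ∑ j, M.adjugate i j • (φ j).smulRight (v i)) = M.det • ∑ j, (φ j).smulRight (v j) := by
    ext x
    set a : Fin m → ℂ := M.adjugate.mulVec fun j => φ j x with ha
    have h0 : ∀ i, ∑ j, M.adjugate i j * φ j x = a i := fun i => rfl
    have h1 : ∀ i, a i + φ i (D (∑ j, a j • v j)) = M.det * φ i x := by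
      intro i
      have := congrFun (congrArg (fun A : Matrix (Fin m) (Fin m) ℂ => A.mulVec fun j => φ j x)
        M.mul_adjugate) i
      simp only [← Matrix.mulVec_mulVec, Matrix.smul_mulVec, Matrix.one_mulVec, Pi.smul_apply,
        smul_eq_mul] at this
      rw [← this, ← ha, hM, Matrix.add_mulVec, Matrix.one_mulVec, Pi.add_apply]
      congr 1
      simp [Matrix.mulVec, dotProduct, mul_comm]
    simp only [mul_apply_eq_comp, add_apply, one_apply_eq_self, sum_apply, smul_apply,
      ContinuousLinearMap.smulRight_apply, smul_smul, ← Finset.sum_smul, h0, Finset.smul_sum]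
    rw [← Finset.sum_add_distrib]
    simp only [← add_smul, h1]
  -- Sliding `D` to the left reduces the claim to `1 + K D`, which has the same matrix `M`.
  have e : (1 + D * ∑ j, (φ j).smulRight (v j)) * D =
      D * (1 + (∑ j, (φ j).smulRight (v j)) * D) := by noncomm_ring
  rw [cramerInverse, mul_sub, ← mul_assoc, e, mul_assoc, key, mul_smul_comm, mul_one, smul_add,
    mul_smul_comm, add_sub_cancel_right]

/-- A null vector `a` of the matrix lifts to `x = D (∑ aⱼ vⱼ)`. Since `φ i x = -aᵢ`, this `x` is
nonzero and `D K x = -x`. -/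
theorem exists_ne_zero_of_det_eq_zero {m : ℕ} (φ : Fin m → E →L[ℂ] ℂ) (v : Fin m → E)
    (D : E →L[ℂ] E) (h : (1 + Matrix.of fun i j => φ i (D (v j))).det = 0) :
    ∃ x ≠ 0, (1 + D * ∑ j, (φ j).smulRight (v j)) x = 0 := by
  obtain ⟨a, ha, ha'⟩ := Matrix.exists_mulVec_eq_zero_iff.2 h
  have h1 : ∀ i, φ i (D (∑ j, a j • v j)) = - a i := by
    intro i
    have := congrFun ha' i
    rw [Matrix.add_mulVec, Matrix.one_mulVec, Pi.add_apply, add_comm] at this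
    rw [← add_eq_zero_iff_eq_neg, ← Pi.zero_apply (M := fun _ => ℂ) i, ← this]
    congr 1
    simp [Matrix.mulVec, dotProduct, mul_comm]
  refine ⟨D (∑ j, a j • v j), ?_, ?_⟩
  · intro h0
    apply ha
    ext i
    have := h1 i
    rw [h0, map_zero, eq_comm, neg_eq_zero] at this
    exact this
  · simp only [mul_apply_eq_comp, add_apply, one_apply_eq_self, sum_apply,
      ContinuousLinearMap.smulRight_apply, h1, ← map_add]
    rw [← Finset.sum_add_distrib]
    simp

theorem exists_smulRight_sum (V : Submodule ℂ E) [FiniteDimensional ℂ V] (P : E →L[ℂ] E)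
    (hP : ∀ x, P x ∈ V) :
    ∃ (m : ℕ) (φ : Fin m → E →L[ℂ] ℂ) (v : Fin m → E), P = ∑ j, (φ j).smulRight (v j) := by
  let b := Module.finBasis ℂ V
  refine ⟨_, fun j => (LinearMap.toContinuousLinearMap (b.coord j)) ∘L (P.codRestrict V hP),
    fun j => b j, ?_⟩
  ext x
  have h := b.sum_repr (P.codRestrict V hP x)
  have h' := congrArg (fun y : V => (y : E)) h
  simp only [Submodule.coe_sum, Submodule.coe_smul] at h'
  simpa using h'.symm

/-- Local form of the analytic Fredholm theorem. -/
theorem exists_local_inverse {E : Type*} [NormedAddCommGroup E] [InnerProductSpace ℂ E]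
    [CompleteSpace E] {G : ℂ → E →L[ℂ] E} {z : ℂ} (hG : ∀ᶠ w in 𝓝 z, DifferentiableAt ℂ G w)
    (hK : IsCompactOperator (G z)) :
    ∃ (d : ℂ → ℂ) (Y : ℂ → E →L[ℂ] E) (W : Submodule ℂ E),
      AnalyticAt ℂ d z ∧ (∀ᶠ w in 𝓝 z, DifferentiableAt ℂ Y w) ∧ FiniteDimensional ℂ W ∧
      (∀ x, (1 + G z) x = 0 → x ∈ W) ∧
      ∀ᶠ w in 𝓝 z, (1 + G w) * Y w = d w • 1 ∧ Y w * (1 + G w) = d w • 1 ∧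
        (d w = 0 → ∃ x ≠ 0, (1 + G w) x = 0) := by
  -- Any bound below 1 would do: it makes `1 + (G z - Q)` invertible by a Neumann series. The
  -- finite-rank part `Q` is frozen at `z`, so compactness is needed only there.
  obtain ⟨V, hV, hVε⟩ := exists_finiteDimensional_approx hK (ε := 1 / 2) (by norm_num)
  obtain ⟨m, φ, v, hφ⟩ := exists_smulRight_sum V (V.starProjection * G z) (fun x => by
    simp [Submodule.starProjection_apply_mem])
  set Q := V.starProjection * G z with hQ
  have hunit : IsUnit (1 + (G z - Q)) := by
    have h1 : ‖-(G z - Q)‖ < 1 := by rw [norm_neg]; linarith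
    have h2 := (Units.oneSub (-(G z - Q)) h1).isUnit
    rwa [Units.val_oneSub, sub_neg_eq_add] at h2
  have hcont : ContinuousAt (fun w => 1 + (G w - Q)) z := by
    have := hG.self_of_nhds.continuousAt
    fun_prop
  have hU : ∀ᶠ w in 𝓝 z, IsUnit (1 + (G w - Q)) :=
    hcont.preimage_mem_nhds (Units.isOpen.mem_nhds hunit)
  set D : ℂ → E →L[ℂ] E := fun w => Ring.inverse (1 + (G w - Q)) with hD
  have hDd : ∀ᶠ w in 𝓝 z, DifferentiableAt ℂ D w := by
    filter_upwards [hG, hU] with w h1 h2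
    have h3 : DifferentiableAt ℂ (fun w => 1 + (G w - Q)) w := by fun_prop
    exact (differentiableAt_inverse (𝕜 := ℂ) h2).comp w h3
  have hfact : ∀ w, IsUnit (1 + (G w - Q)) → 1 + G w = (1 + (G w - Q)) * (1 + D w * Q) := by
    intro w hw
    rw [mul_add, mul_one, ← mul_assoc, Ring.mul_inverse_cancel _ hw, one_mul]
    abel
  set M : ℂ → Matrix (Fin m) (Fin m) ℂ := fun w => 1 + Matrix.of fun i j => φ i (D w (v j)) with hM
  have hMd : ∀ᶠ w in 𝓝 z, ∀ i j, DifferentiableAt ℂ (fun w => M w i j) w := by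
    filter_upwards [hDd] with w hw i j
    simp only [hM, Matrix.add_apply, Matrix.of_apply]
    fun_prop
  -- From `1 + G w = (1 + (G w - Q)) (1 + D w Q)`: the first factor is inverted by `D w`, the second
  -- by Cramer's rule. A null vector at `z` satisfies `x = -D z (Q x)`, hence this choice of `W`.
  refine ⟨fun w => (M w).det, fun w => cramerInverse φ v (D w) * D w,
    LinearMap.range ((D z * Q).toLinearMap), ?_, ?_, ?_, ?_, ?_⟩
  · obtain ⟨s, hs, hs', hzs⟩ := eventually_nhds_iff.1 hMd
    exact DifferentiableOn.analyticAt (s := s)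
      (fun w hw => (differentiableAt_det (hs w hw)).differentiableWithinAt) (hs'.mem_nhds hzs)
  · filter_upwards [hDd, hMd] with w h1 h2
    have h3 := differentiableAt_det h2
    have h4 := differentiableAt_adjugate h2
    simp only [cramerInverse]
    refine DifferentiableAt.mul ?_ h1
    refine DifferentiableAt.sub (h3.smul_const _) (h1.mul ?_)
    exact DifferentiableAt.fun_sum fun i _ => DifferentiableAt.fun_sum fun j _ =>
      (h4 i j).smul_const _
  · have : (D z * Q).toLinearMap.range =
        (((D z).toLinearMap ∘ₗ V.subtype) ∘ₗ
          (Q.toLinearMap.codRestrict V fun x => by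
            simp [hQ, Submodule.starProjection_apply_mem])).range := by
      congr 1
    rw [this]
    exact Submodule.finiteDimensional_of_le (LinearMap.range_comp_le_range _ _)
  · intro x hx
    have hz := hfact z hU.self_of_nhds
    rw [hz] at hx
    have h1 : ((1 : E →L[ℂ] E) + D z * Q) x = 0 := by
      have := congrArg (Ring.inverse (1 + (G z - Q)) : E →L[ℂ] E) hx
      rwa [← mul_apply_eq_comp, ← mul_assoc, Ring.inverse_mul_cancel _ hU.self_of_nhds, one_mul,
        map_zero] at this
    refine ⟨-x, ?_⟩
    rw [map_neg, neg_eq_iff_add_eq_zero, add_comm]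
    exact h1
  · filter_upwards [hU] with w hw
    have hf := hfact w hw
    have h1 := mul_cramerInverse φ v (D w)
    have h2 := cramerInverse_mul φ v (D w)
    rw [← hφ] at h1 h2
    refine ⟨?_, ?_, ?_⟩
    · rw [hf, mul_assoc, ← mul_assoc (1 + D w * Q) (cramerInverse φ v (D w)), h1, smul_mul_assoc,
        one_mul, mul_smul_comm, Ring.mul_inverse_cancel _ hw]
    · rw [hf, mul_assoc, ← mul_assoc (D w), Ring.inverse_mul_cancel _ hw, one_mul, h2]
    · intro h0
      obtain ⟨x, hx, hx'⟩ := exists_ne_zero_of_det_eq_zero φ v (D w) h0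
      refine ⟨x, hx, ?_⟩
      rw [hf, mul_apply_eq_comp, hφ, hx', map_zero]

end FredholmTheory

end

/-! ### Coupled 3×3 systems: Schur complement and factorization -/

noncomputable section

open Filter Topology

/-- An operator `A` on `E ≃ H × H × H` that is, up to bounded off-diagonal terms coupling the third
component with the other two, the direct sum of the operators `T₁`, `T₂`, `T₃` on `H`. -/
structure CoupledSystem (E H : Type*) [NormedAddCommGroup E] [NormedSpace ℂ E]
    [NormedAddCommGroup H] [NormedSpace ℂ H] where
  (p₁ p₂ p₃ : E →L[ℂ] H)
  (i₁ i₂ i₃ : H →L[ℂ] E)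
  (b₁₃ b₂₃ b₃₁ b₃₂ : H →L[ℂ] H)
  (T₁ T₂ T₃ : H →ₗ.[ℂ] H)
  A : E →ₗ.[ℂ] E
  p₁_i₁ : ∀ x, p₁ (i₁ x) = x
  p₁_i₂ : ∀ x, p₁ (i₂ x) = 0
  p₁_i₃ : ∀ x, p₁ (i₃ x) = 0
  p₂_i₁ : ∀ x, p₂ (i₁ x) = 0
  p₂_i₂ : ∀ x, p₂ (i₂ x) = x
  p₂_i₃ : ∀ x, p₂ (i₃ x) = 0
  p₃_i₁ : ∀ x, p₃ (i₁ x) = 0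
  p₃_i₂ : ∀ x, p₃ (i₂ x) = 0
  p₃_i₃ : ∀ x, p₃ (i₃ x) = x
  sum_i_p : ∀ u, i₁ (p₁ u) + i₂ (p₂ u) + i₃ (p₃ u) = u
  graph_iff : ∀ u g, (u, g) ∈ A.graph ↔ (p₁ u, p₁ g - b₁₃ (p₃ u)) ∈ T₁.graph ∧
    (p₂ u, p₂ g - b₂₃ (p₃ u)) ∈ T₂.graph ∧ (p₃ u, p₃ g - b₃₁ (p₁ u) - b₃₂ (p₂ u)) ∈ T₃.graph

namespace CoupledSystem

open LinearPMap (isResolventAt_iff)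

section

variable {E H : Type*} [NormedAddCommGroup E] [NormedSpace ℂ E]
    [NormedAddCommGroup H] [NormedSpace ℂ H] (S : CoupledSystem E H)

attribute [simp] p₁_i₁ p₁_i₂ p₁_i₃ p₂_i₁ p₂_i₂ p₂_i₃ p₃_i₁ p₃_i₂ p₃_i₃

theorem ext_iff_components {u v : E} :
    u = v ↔ S.p₁ u = S.p₁ v ∧ S.p₂ u = S.p₂ v ∧ S.p₃ u = S.p₃ v := by
  refine ⟨by rintro rfl; simp, fun ⟨h1, h2, h3⟩ => ?_⟩
  rw [← S.sum_i_p u, h1, h2, h3, S.sum_i_p]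

theorem graph_iff_resolvent {z₁ z₂ z₃ : ℂ} {R₁ R₂ R₃ : H →L[ℂ] H}
    (h₁ : S.T₁.IsResolventAt z₁ R₁) (h₂ : S.T₂.IsResolventAt z₂ R₂)
    (h₃ : S.T₃.IsResolventAt z₃ R₃) (u g : E) :
    (u, g) ∈ S.A.graph ↔ R₁ (S.p₁ g - S.b₁₃ (S.p₃ u) - z₁ • S.p₁ u) = S.p₁ u ∧
      R₂ (S.p₂ g - S.b₂₃ (S.p₃ u) - z₂ • S.p₂ u) = S.p₂ u ∧
      R₃ (S.p₃ g - S.b₃₁ (S.p₁ u) - S.b₃₂ (S.p₂ u) - z₃ • S.p₃ u) = S.p₃ u := by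
  rw [S.graph_iff, isResolventAt_iff.1 h₁, isResolventAt_iff.1 h₂, isResolventAt_iff.1 h₃]

/-! ### The Schur complement -/

/-- `-(b₃₁ R₁ b₁₃ + b₃₂ R₂ b₂₃)`. -/
def feedback (R₁ R₂ : H →L[ℂ] H) : H →L[ℂ] H := -(S.b₃₁ * R₁ * S.b₁₃ + S.b₃₂ * R₂ * S.b₂₃)

theorem feedback_apply (R₁ R₂ : H →L[ℂ] H) (v : H) :
    S.feedback R₁ R₂ v = -(S.b₃₁ (R₁ (S.b₁₃ v)) + S.b₃₂ (R₂ (S.b₂₃ v))) := rfl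

/-- Block elimination: the first two rows give `p₁ u` and `p₂ u` in terms of `p₃ u`, and
substitution turns the third into an equation for `p₃ u` alone. -/
theorem graph_iff_schur {z : ℂ} {R₁ R₂ R₃ : H →L[ℂ] H}
    (h₁ : S.T₁.IsResolventAt z R₁) (h₂ : S.T₂.IsResolventAt z R₂)
    (h₃ : S.T₃.IsResolventAt z R₃) {u g f : E} (hf : g - z • u = f) :
    (u, g) ∈ S.A.graph ↔ S.p₁ u = R₁ (S.p₁ f - S.b₁₃ (S.p₃ u)) ∧
      S.p₂ u = R₂ (S.p₂ f - S.b₂₃ (S.p₃ u)) ∧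
      (1 + R₃ * S.feedback R₁ R₂) (S.p₃ u) =
        R₃ (S.p₃ f - S.b₃₁ (R₁ (S.p₁ f)) - S.b₃₂ (R₂ (S.p₂ f))) := by
  have e1 : S.p₁ g - S.b₁₃ (S.p₃ u) - z • S.p₁ u = S.p₁ f - S.b₁₃ (S.p₃ u) := by
    rw [← hf, map_sub, map_smul]; abel
  have e2 : S.p₂ g - S.b₂₃ (S.p₃ u) - z • S.p₂ u = S.p₂ f - S.b₂₃ (S.p₃ u) := by
    rw [← hf, map_sub, map_smul]; abel
  have e3 : S.p₃ g - S.b₃₁ (S.p₁ u) - S.b₃₂ (S.p₂ u) - z • S.p₃ u =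
      S.p₃ f - S.b₃₁ (S.p₁ u) - S.b₃₂ (S.p₂ u) := by
    rw [← hf, map_sub, map_smul]; abel
  rw [S.graph_iff_resolvent h₁ h₂ h₃, e1, e2, e3, eq_comm, @eq_comm _ _ (S.p₂ u)]
  refine and_congr_right fun H1 => and_congr_right fun H2 => ?_
  rw [H1, H2, add_apply, one_apply_eq_self, mul_apply_eq_comp, feedback_apply]
  simp only [map_sub, map_add, map_neg]
  rw [← sub_eq_zero, ← sub_eq_zero (b := R₃ (S.p₃ f) - _ - _), ← neg_eq_zero]
  refine Eq.congr ?_ rfl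
  abel

theorem mem_resolventSet_iff {z : ℂ} {R₁ R₂ R₃ : H →L[ℂ] H}
    (h₁ : S.T₁.IsResolventAt z R₁) (h₂ : S.T₂.IsResolventAt z R₂)
    (h₃ : S.T₃.IsResolventAt z R₃) :
    z ∈ S.A.resolventSet ↔ IsUnit (1 + R₃ * S.feedback R₁ R₂) := by
  constructor
  · rintro ⟨X, hX⟩
    rw [isResolventAt_iff] at hX
    -- With `F` the feedback, the third component `v` of `X (i₃ (F x))` solves `(1 + R₃ F) v = R₃ F
    -- x`, so `x - v` is a preimage of `x`.
    have hr : (1 + R₃ * S.feedback R₁ R₂) * (1 - S.p₃ ∘L X ∘L S.i₃ ∘L S.feedback R₁ R₂) = 1 := by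
      ext x
      set f := S.i₃ (S.feedback R₁ R₂ x) with hf
      have h := (hX (X f) (f + z • X f)).2 (by rw [add_sub_cancel_right])
      have h3 := ((S.graph_iff_schur h₁ h₂ h₃ (add_sub_cancel_right f (z • X f))).1 h).2.2
      simp only [hf, p₁_i₃, p₂_i₃, p₃_i₃, map_zero, sub_zero] at h3
      rw [mul_apply_eq_comp, sub_apply, map_sub]
      simp only [ContinuousLinearMap.comp_apply, one_apply_eq_self]
      rw [h3, add_apply, mul_apply_eq_comp, one_apply_eq_self, add_sub_cancel_right]
    have hinj : ∀ v, (1 + R₃ * S.feedback R₁ R₂) v = 0 → v = 0 := by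
      intro v hv
      -- Back substitution lifts a null vector `v` of the Schur complement to a solution of `A u = z
      -- u`.
      set u := S.i₁ (R₁ (-S.b₁₃ v)) + S.i₂ (R₂ (-S.b₂₃ v)) + S.i₃ v with hu
      have h : (u, z • u) ∈ S.A.graph := by
        rw [S.graph_iff_schur h₁ h₂ h₃ (sub_self (z • u))]
        simp only [hu, map_add, p₁_i₁, p₁_i₂, p₁_i₃, p₂_i₁, p₂_i₂, p₂_i₃, p₃_i₁, p₃_i₂, p₃_i₃,
          map_zero, zero_sub, add_zero, zero_add, sub_zero, true_and]
        rw [hv]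
      rw [hX, sub_self, map_zero] at h
      have : S.p₃ u = v := by simp [hu]
      rw [← this, ← h, map_zero]
    refine isUnit_iff_exists.2 ⟨_, hr, ?_⟩
    ext x
    refine sub_eq_zero.1 (hinj _ ?_)
    rw [map_sub, ← mul_apply_eq_comp, ← mul_assoc, hr, one_mul, one_apply_eq_self, sub_self]
  · intro hu
    set J := Ring.inverse (1 + R₃ * S.feedback R₁ R₂) with hJ
    have hJ1 : ∀ x y, (1 + R₃ * S.feedback R₁ R₂) x = y ↔ x = J y := by
      intro x y
      constructor
      · rintro rfl
        rw [← mul_apply_eq_comp, Ring.inverse_mul_cancel _ hu, one_apply_eq_self]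
      · rintro rfl
        rw [← mul_apply_eq_comp, Ring.mul_inverse_cancel _ hu, one_apply_eq_self]
    -- The third component of the resolvent; the other two follow from it by back substitution.
    set V : E →L[ℂ] H := J ∘L R₃ ∘L (S.p₃ - S.b₃₁ ∘L R₁ ∘L S.p₁ - S.b₃₂ ∘L R₂ ∘L S.p₂) with hV
    refine ⟨S.i₁ ∘L R₁ ∘L (S.p₁ - S.b₁₃ ∘L V) + S.i₂ ∘L R₂ ∘L (S.p₂ - S.b₂₃ ∘L V) + S.i₃ ∘L V,
      isResolventAt_iff.2 fun u g => ?_⟩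
    rw [S.graph_iff_schur h₁ h₂ h₃ rfl, hJ1, eq_comm (a := _) (b := u), S.ext_iff_components]
    simp only [add_apply, ContinuousLinearMap.comp_apply, map_add, p₁_i₁, p₁_i₂, p₁_i₃, p₂_i₁,
      p₂_i₂, p₂_i₃, p₃_i₁, p₃_i₂, p₃_i₃, add_zero, zero_add, sub_apply]
    have hV' : ∀ f, V f = J (R₃ (S.p₃ f - S.b₃₁ (R₁ (S.p₁ f)) - S.b₃₂ (R₂ (S.p₂ f)))) :=
      fun f => rfl
    rw [← hV']
    constructor
    · rintro ⟨h1, h2, h3⟩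
      rw [← h3]
      exact ⟨h1, h2, rfl⟩
    · rintro ⟨h1, h2, h3⟩
      rw [← h3] at h1 h2
      exact ⟨h1, h2, h3⟩

/-! ### Reduction to a compact perturbation of the identity -/

/-- The block-diagonal operator with blocks `R₁`, `R₂`, `R₃`. -/
def diag (R₁ R₂ R₃ : H →L[ℂ] H) : E →L[ℂ] E :=
  S.i₁ ∘L R₁ ∘L S.p₁ + S.i₂ ∘L R₂ ∘L S.p₂ + S.i₃ ∘L R₃ ∘L S.p₃

/-- The nilpotent part of `(A - w) diag R₁ R₂ R₃`. -/
def nilPart (R₃ : H →L[ℂ] H) : E →L[ℂ] E :=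
  (S.i₁ ∘L S.b₁₃ + S.i₂ ∘L S.b₂₃) ∘L R₃ ∘L S.p₃

/-- The part of `(A - w) diag R₁ R₂ R₃` that is compact when `R₁` and `R₂` are, where `R₁`, `R₂` are
resolvents at `z₁`, `z₂`. -/
def compactPart (z₁ z₂ w : ℂ) (R₁ R₂ : H →L[ℂ] H) : E →L[ℂ] E :=
  ((z₁ - w) • S.i₁ + S.i₃ ∘L S.b₃₁) ∘L R₁ ∘L S.p₁ + ((z₂ - w) • S.i₂ + S.i₃ ∘L S.b₃₂) ∘L R₂ ∘L S.p₂

/-- It reads only the third component and writes only into the first two. -/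
theorem nilPart_mul_self (R₃ : H →L[ℂ] H) : S.nilPart R₃ * S.nilPart R₃ = 0 := by
  ext x
  simp [nilPart]

theorem one_sub_mul_one_add_nilPart (R₃ : H →L[ℂ] H) :
    (1 - S.nilPart R₃) * (1 + S.nilPart R₃) = 1 := by
  have h := S.nilPart_mul_self R₃
  rw [sub_mul, one_mul, mul_add, mul_one, h]
  abel

theorem one_add_mul_one_sub_nilPart (R₃ : H →L[ℂ] H) :
    (1 + S.nilPart R₃) * (1 - S.nilPart R₃) = 1 := by
  have h := S.nilPart_mul_self R₃
  rw [add_mul, one_mul, mul_sub, mul_one, h]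
  abel

/-- The domain of `A` is the range of `diag`. Since `R₁`, `R₂` are taken at `z₁`, `z₂` instead of
`w`, the errors `(z₁ - w) R₁` and `(z₂ - w) R₂` appear, and they go into `compactPart`. -/
theorem graph_iff_exists {z₁ z₂ w : ℂ} {R₁ R₂ R₃ : H →L[ℂ] H}
    (h₁ : S.T₁.IsResolventAt z₁ R₁) (h₂ : S.T₂.IsResolventAt z₂ R₂)
    (h₃ : S.T₃.IsResolventAt w R₃) (u g : E) :
    (u, g) ∈ S.A.graph ↔ ∃ x, S.diag R₁ R₂ R₃ x = u ∧
      (1 + S.nilPart R₃ + S.compactPart z₁ z₂ w R₁ R₂) x = g - w • u := by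
  rw [S.graph_iff_resolvent h₁ h₂ h₃]
  constructor
  · rintro ⟨h1, h2, h3⟩
    -- The components of `x` are `(Tⱼ - zⱼ) pⱼ u`, with `w` in the role of `z₃`.
    obtain ⟨x₁, hx₁⟩ : ∃ x, x = S.p₁ g - S.b₁₃ (S.p₃ u) - z₁ • S.p₁ u := ⟨_, rfl⟩
    obtain ⟨x₂, hx₂⟩ : ∃ x, x = S.p₂ g - S.b₂₃ (S.p₃ u) - z₂ • S.p₂ u := ⟨_, rfl⟩
    obtain ⟨x₃, hx₃⟩ : ∃ x, x = S.p₃ g - S.b₃₁ (S.p₁ u) - S.b₃₂ (S.p₂ u) - w • S.p₃ u := ⟨_, rfl⟩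
    rw [← hx₁] at h1
    rw [← hx₂] at h2
    rw [← hx₃] at h3
    refine ⟨S.i₁ x₁ + S.i₂ x₂ + S.i₃ x₃, ?_, ?_⟩
    · rw [S.ext_iff_components]
      simp [diag, h1, h2, h3]
    · rw [S.ext_iff_components]
      simp only [compactPart, nilPart, add_apply, one_apply_eq_self,
        ContinuousLinearMap.comp_apply, map_add, p₁_i₁, p₁_i₂, p₁_i₃, p₂_i₁,
        p₂_i₂, p₂_i₃, p₃_i₁, p₃_i₂, p₃_i₃, add_zero, zero_add, smul_apply, map_smul, h1, h2, h3,
        smul_zero, map_sub, map_zero]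
      simp only [hx₁, hx₂, hx₃]
      refine ⟨?_, ?_, ?_⟩ <;> module
  · rintro ⟨x, rfl, hx⟩
    rw [S.ext_iff_components] at hx
    have hd : S.p₁ (S.diag R₁ R₂ R₃ x) = R₁ (S.p₁ x) ∧ S.p₂ (S.diag R₁ R₂ R₃ x) = R₂ (S.p₂ x) ∧
        S.p₃ (S.diag R₁ R₂ R₃ x) = R₃ (S.p₃ x) := by
      simp [diag]
    simp only [compactPart, nilPart, add_apply, one_apply_eq_self,
      ContinuousLinearMap.comp_apply, map_add, p₁_i₁, p₁_i₂, p₁_i₃, p₂_i₁,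
      p₂_i₂, p₂_i₃, p₃_i₁, p₃_i₂, p₃_i₃, add_zero, zero_add, smul_apply, map_smul,
      smul_zero, map_sub, hd] at hx
    simp only [hd]
    obtain ⟨h1, h2, h3⟩ := hx
    refine ⟨congrArg R₁ ?_, congrArg R₂ ?_, congrArg R₃ ?_⟩
    · rw [sub_right_comm, sub_eq_iff_eq_add, sub_eq_iff_eq_add]
      rw [eq_sub_iff_add_eq] at h1
      rw [← h1]; module
    · rw [sub_right_comm, sub_eq_iff_eq_add, sub_eq_iff_eq_add]
      rw [eq_sub_iff_add_eq] at h2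
      rw [← h2]; module
    · rw [eq_sub_iff_add_eq] at h3
      rw [← h3]; module

end

end CoupledSystem
end

/-! ### Coupled systems: discreteness of the spectrum off the half-line -/

noncomputable section

open Filter Topology

namespace CoupledSystem

open LinearPMap (isResolventAt_iff)

section

variable {E H : Type*} [NormedAddCommGroup E] [NormedSpace ℂ E]
    [NormedAddCommGroup H] [NormedSpace ℂ H] (S : CoupledSystem E H)

/-- Resolvents are injective because graphs are single-valued over 0. This keeps the eigenvectors
produced from null vectors of `1 + G` nonzero. -/
theorem diag_injective {z₁ z₂ w : ℂ} {R₁ R₂ R₃ : H →L[ℂ] H}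
    (h₁ : S.T₁.IsResolventAt z₁ R₁) (h₂ : S.T₂.IsResolventAt z₂ R₂)
    (h₃ : S.T₃.IsResolventAt w R₃) {x : E} (hx : S.diag R₁ R₂ R₃ x = 0) : x = 0 := by
  have inj : ∀ {T : H →ₗ.[ℂ] H} {z : ℂ} {R : H →L[ℂ] H}, T.IsResolventAt z R →
      ∀ y, R y = 0 → y = 0 := by
    intro T z R hR y hy
    have h1 := (isResolventAt_iff.1 hR (R y) (y + z • R y)).2 (by rw [add_sub_cancel_right])
    rw [hy, smul_zero, add_zero] at h1
    exact T.graph_fst_eq_zero_snd h1 rfl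
  have hd : S.p₁ (S.diag R₁ R₂ R₃ x) = R₁ (S.p₁ x) ∧ S.p₂ (S.diag R₁ R₂ R₃ x) = R₂ (S.p₂ x) ∧
      S.p₃ (S.diag R₁ R₂ R₃ x) = R₃ (S.p₃ x) := by
    simp [diag]
  rw [hx] at hd
  simp only [map_zero] at hd
  rw [S.ext_iff_components]
  simp only [map_zero]
  exact ⟨inj h₁ _ hd.1.symm, inj h₂ _ hd.2.1.symm, inj h₃ _ hd.2.2.symm⟩

/-- `(A - w) diag = (1 + N) (1 + G)` with this `G`. -/
def perturbation (z₁ z₂ w : ℂ) (R₁ R₂ R₃ : H →L[ℂ] H) : E →L[ℂ] E :=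
  (1 - S.nilPart R₃) * S.compactPart z₁ z₂ w R₁ R₂

theorem one_add_mul_one_add_perturbation (z₁ z₂ w : ℂ) (R₁ R₂ R₃ : H →L[ℂ] H) :
    (1 + S.nilPart R₃) * (1 + S.perturbation z₁ z₂ w R₁ R₂ R₃) =
      1 + S.nilPart R₃ + S.compactPart z₁ z₂ w R₁ R₂ := by
  rw [perturbation, mul_add, mul_one, ← mul_assoc, one_add_mul_one_sub_nilPart, one_mul]

theorem one_add_perturbation (z₁ z₂ w : ℂ) (R₁ R₂ R₃ : H →L[ℂ] H) :
    1 + S.perturbation z₁ z₂ w R₁ R₂ R₃ =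
      (1 - S.nilPart R₃) * (1 + S.nilPart R₃ + S.compactPart z₁ z₂ w R₁ R₂) := by
  rw [← one_add_mul_one_add_perturbation, ← mul_assoc, one_sub_mul_one_add_nilPart, one_mul]

theorem eigenvector_iff {z₁ z₂ w : ℂ} {R₁ R₂ R₃ : H →L[ℂ] H}
    (h₁ : S.T₁.IsResolventAt z₁ R₁) (h₂ : S.T₂.IsResolventAt z₂ R₂)
    (h₃ : S.T₃.IsResolventAt w R₃) (u : E) :
    (u, w • u) ∈ S.A.graph ↔ ∃ x, S.diag R₁ R₂ R₃ x = u ∧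
      (1 + S.perturbation z₁ z₂ w R₁ R₂ R₃) x = 0 := by
  rw [S.graph_iff_exists h₁ h₂ h₃]
  refine exists_congr fun x => and_congr_right fun _ => ?_
  rw [sub_self]
  constructor
  · intro h
    rw [one_add_perturbation, mul_apply_eq_comp, h, map_zero]
  · intro h
    rw [← one_add_mul_one_add_perturbation, mul_apply_eq_comp, h, map_zero]

/-- From `(A - w) diag = (1 + N)(1 + G)` the resolvent is `diag (1 + G)⁻¹ (1 - N)`, where `(1 + G)⁻¹
= d⁻¹ Y`. -/
theorem isResolventAt_of_inverse {z₁ z₂ w : ℂ} {R₁ R₂ R₃ : H →L[ℂ] H}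
    (h₁ : S.T₁.IsResolventAt z₁ R₁) (h₂ : S.T₂.IsResolventAt z₂ R₂)
    (h₃ : S.T₃.IsResolventAt w R₃) {Y : E →L[ℂ] E} {d : ℂ} (hd : d ≠ 0)
    (hr : (1 + S.perturbation z₁ z₂ w R₁ R₂ R₃) * Y = d • 1)
    (hl : Y * (1 + S.perturbation z₁ z₂ w R₁ R₂ R₃) = d • 1) :
    S.A.IsResolventAt w (d⁻¹ • (S.diag R₁ R₂ R₃ * Y * (1 - S.nilPart R₃))) := by
  set X := 1 + S.nilPart R₃ + S.compactPart z₁ z₂ w R₁ R₂ with hX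
  have e1 : X * (Y * (1 - S.nilPart R₃)) = d • 1 := by
    rw [hX, ← one_add_mul_one_add_perturbation, mul_assoc, ← mul_assoc _ Y, hr, smul_mul_assoc,
      one_mul, mul_smul_comm, one_add_mul_one_sub_nilPart]
  have e2 : (Y * (1 - S.nilPart R₃)) * X = d • 1 := by
    rw [mul_assoc, hX, ← one_add_perturbation, hl]
  have e1' : ∀ y, X (Y ((1 - S.nilPart R₃) y)) = d • y := fun y =>
    congrArg (fun T : E →L[ℂ] E => T y) e1
  have e2' : ∀ y, Y ((1 - S.nilPart R₃) (X y)) = d • y := fun y =>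
    congrArg (fun T : E →L[ℂ] E => T y) e2
  rw [isResolventAt_iff]
  intro u g
  rw [S.graph_iff_exists h₁ h₂ h₃]
  simp only [smul_apply, mul_apply_eq_comp]
  constructor
  · rintro ⟨x, hx, hx'⟩
    rw [← hx', e2', map_smul, smul_smul, inv_mul_cancel₀ hd, one_smul, hx]
  · intro h
    refine ⟨d⁻¹ • Y ((1 - S.nilPart R₃) (g - w • u)), by rw [map_smul, h], ?_⟩
    rw [map_smul, e1', smul_smul, inv_mul_cancel₀ hd, one_smul]

theorem isCompactOperator_perturbation (z₁ z₂ w : ℂ) {R₁ R₂ : H →L[ℂ] H} (R₃ : H →L[ℂ] H)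
    (h₁ : IsCompactOperator R₁) (h₂ : IsCompactOperator R₂) :
    IsCompactOperator (S.perturbation z₁ z₂ w R₁ R₂ R₃) := by
  have hC : IsCompactOperator (S.compactPart z₁ z₂ w R₁ R₂) :=
    ((h₁.comp_clm S.p₁).clm_comp ((z₁ - w) • S.i₁ + S.i₃ ∘L S.b₃₁)).add
      ((h₂.comp_clm S.p₂).clm_comp ((z₂ - w) • S.i₂ + S.i₃ ∘L S.b₃₂))
  exact hC.clm_comp (1 - S.nilPart R₃)

end

section

variable {E H : Type*} [NormedAddCommGroup E] [InnerProductSpace ℂ E]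
    [NormedAddCommGroup H] [InnerProductSpace ℂ H] (S : CoupledSystem E H)

/-- Pair `T v = -t v - f` with `v`, take real parts and apply Cauchy–Schwarz. -/
theorem norm_le_of_accretive {T : H →ₗ.[ℂ] H}
    (hT : ∀ v g, (v, g) ∈ T.graph → 0 ≤ (inner ℂ v g).re) {t : ℝ} {v f : H}
    (h : (v, -((t : ℂ) • v) - f) ∈ T.graph) : t * ‖v‖ ≤ ‖f‖ := by
  have h1 := hT _ _ h
  rw [inner_sub_right, inner_neg_right, inner_smul_right, inner_self_eq_norm_sq_to_K] at h1
  have h2 : (-((t : ℂ) * ((‖v‖ : ℝ) : ℂ) ^ 2) - inner ℂ v f).re =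
      -(t * ‖v‖ ^ 2) - (inner ℂ v f).re := by
    rw [Complex.sub_re, Complex.neg_re, ← Complex.ofReal_pow, ← Complex.ofReal_mul,
      Complex.ofReal_re]
  have h3 : 0 ≤ -(t * ‖v‖ ^ 2) - (inner ℂ v f).re := h2 ▸ h1
  have h4 : -(inner ℂ v f).re ≤ ‖v‖ * ‖f‖ :=
    ((neg_le_abs _).trans (Complex.abs_re_le_norm _)).trans (norm_inner_le_norm v f)
  rcases eq_or_lt_of_le (norm_nonneg v) with h0 | h0
  · rw [← h0, mul_zero]
    exact norm_nonneg f
  · have h5 : ‖v‖ * (t * ‖v‖) ≤ ‖v‖ * ‖f‖ := by nlinarith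
    exact le_of_mul_le_mul_left h5 h0

theorem exists_neg_not_eigenvalue
    (hT₁ : ∀ v g, (v, g) ∈ S.T₁.graph → 0 ≤ (inner ℂ v g).re)
    (hT₂ : ∀ v g, (v, g) ∈ S.T₂.graph → 0 ≤ (inner ℂ v g).re)
    (hT₃ : ∀ v g, (v, g) ∈ S.T₃.graph → 0 ≤ (inner ℂ v g).re) :
    ∃ t : ℝ, 0 < t ∧ ∀ u, (u, (-(t : ℂ)) • u) ∈ S.A.graph → u = 0 := by
  set κ := ‖S.b₁₃‖ + ‖S.b₂₃‖ + ‖S.b₃₁‖ + ‖S.b₃₂‖ with hκ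
  have hκ0 : 0 ≤ κ := by positivity
  have b1 : ‖S.b₁₃‖ ≤ κ := by
    linarith [norm_nonneg S.b₁₃, norm_nonneg S.b₂₃, norm_nonneg S.b₃₁, norm_nonneg S.b₃₂]
  have b2 : ‖S.b₂₃‖ ≤ κ := by
    linarith [norm_nonneg S.b₁₃, norm_nonneg S.b₂₃, norm_nonneg S.b₃₁, norm_nonneg S.b₃₂]
  have b3 : ‖S.b₃₁‖ ≤ κ := by
    linarith [norm_nonneg S.b₁₃, norm_nonneg S.b₂₃, norm_nonneg S.b₃₁, norm_nonneg S.b₃₂]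
  have b4 : ‖S.b₃₂‖ ≤ κ := by
    linarith [norm_nonneg S.b₁₃, norm_nonneg S.b₂₃, norm_nonneg S.b₃₁, norm_nonneg S.b₃₂]
  -- Summing the three component estimates gives `t (n₁ + n₂ + n₃) ≤ κ (n₁ + n₂) + 2 κ n₃`, so `t >
  -- 2 κ` forces `u = 0`.
  refine ⟨2 * κ + 1, by positivity, fun u hu => ?_⟩
  rw [S.graph_iff] at hu
  simp only [neg_smul, map_neg, map_smul] at hu
  obtain ⟨h1, h2, h3⟩ := hu
  rw [sub_sub] at h3
  have e1 := norm_le_of_accretive hT₁ h1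
  have e2 := norm_le_of_accretive hT₂ h2
  have e3 := norm_le_of_accretive hT₃ h3
  have f1 := S.b₁₃.le_of_opNorm_le b1 (S.p₃ u)
  have f2 := S.b₂₃.le_of_opNorm_le b2 (S.p₃ u)
  have f3 := S.b₃₁.le_of_opNorm_le b3 (S.p₁ u)
  have f4 := S.b₃₂.le_of_opNorm_le b4 (S.p₂ u)
  have f5 := norm_add_le (S.b₃₁ (S.p₁ u)) (S.b₃₂ (S.p₂ u))
  have n1 := norm_nonneg (S.p₁ u)
  have n2 := norm_nonneg (S.p₂ u)
  have n3 := norm_nonneg (S.p₃ u)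
  have m1 := mul_nonneg hκ0 n1
  have m2 := mul_nonneg hκ0 n2
  rw [S.ext_iff_components]
  simp only [map_zero]
  refine ⟨norm_le_zero_iff.1 ?_, norm_le_zero_iff.1 ?_, norm_le_zero_iff.1 ?_⟩ <;> linarith

open scoped ComplexOrder in
theorem isPreconnected_compl_nonneg : IsPreconnected (Complex.ofReal '' Set.Ici 0)ᶜ := by
  have h : (Complex.ofReal '' Set.Ici 0)ᶜ = (fun w : ℂ => -w) '' Complex.slitPlane := by
    ext w
    rw [Set.image_neg_eq_neg, Set.mem_neg, Complex.mem_slitPlane_iff_not_le_zero, Set.mem_compl_iff,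
      not_iff_not, neg_nonpos, Set.mem_image]
    constructor
    · rintro ⟨x, hx, rfl⟩
      exact Complex.zero_le_real.2 hx
    · intro hw
      exact ⟨w.re, (Complex.le_def.1 hw).1, (Complex.eq_re_of_ofReal_le hw).symm⟩
  rw [h]
  exact (Complex.starConvex_one_slitPlane.isPathConnected Complex.one_mem_slitPlane).isConnected.isPreconnected.image
    _ continuous_neg.continuousOn

theorem isOpen_compl_nonneg : IsOpen (Complex.ofReal '' Set.Ici 0)ᶜ :=
  (Complex.isometry_ofReal.isClosedEmbedding.isClosedMap _ isClosed_Ici).isOpen_compl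

/-- On a preconnected set, a property that near each point holds identically or fails off that
point, and that fails near some point, fails near every point (with this point removed). -/
theorem eventually_not_of_isPreconnected {U : Set ℂ} (hU : IsPreconnected U) {bad : ℂ → Prop}
    (h : ∀ z ∈ U, (∀ᶠ w in 𝓝 z, bad w) ∨ ∀ᶠ w in 𝓝[≠] z, ¬ bad w) {z₀ : ℂ} (hz₀ : z₀ ∈ U)
    (h₀ : ¬ bad z₀) {z : ℂ} (hz : z ∈ U) : ∀ᶠ w in 𝓝[≠] z, ¬ bad w := by
  set V : Set ℂ := {w | ∀ᶠ w' in 𝓝 w, bad w'} with hV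
  have hVo : IsOpen V := isOpen_setOfPred_eventually_nhds
  refine (h z hz).resolve_left fun hzV => h₀ ?_
  -- At a limit point `w` of `V` the other alternative would clear a punctured neighbourhood, which
  -- the open set `V` meets. The nearby point `y` of `V` may be `w` itself, hence the passage to
  -- some `x ≠ w` close to `y`.
  have hsub : closure V ∩ U ⊆ V := by
    rintro w ⟨hw, hwU⟩
    refine (h w hwU).resolve_right fun hn => ?_
    rw [mem_closure_iff_frequently] at hw
    obtain ⟨y, hy, hy'⟩ := (hw.and_eventually (eventually_nhds_nhdsWithin.2 hn)).exists
    have hne : (𝓝[{w}ᶜ] y).NeBot := mem_closure_iff_nhdsWithin_neBot.1 (dense_compl_singleton w y)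
    obtain ⟨x, hx1, hx2⟩ := ((hy.filter_mono nhdsWithin_le_nhds).and hy').exists
    exact hx2 hx1
  exact (hU.subset_of_closure_inter_subset hVo ⟨z, hz, hzV⟩ hsub hz₀).self_of_nhds

/-- With `z₁`, `z₂` frozen, `G` depends on `w` only through the resolvent of `T₃` and the scalars in
`compactPart`. It is thus analytic across the spectra of `T₁` and `T₂`, and the connectedness
argument can run on `ℂ \ [0, ∞)`. -/
theorem isIsolatedEigenvalueOfFiniteMultiplicity [CompleteSpace E] [CompleteSpace H]
    (hT₁ : ∀ v g, (v, g) ∈ S.T₁.graph → 0 ≤ (inner ℂ v g).re)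
    (hT₂ : ∀ v g, (v, g) ∈ S.T₂.graph → 0 ≤ (inner ℂ v g).re)
    (hT₃ : ∀ v g, (v, g) ∈ S.T₃.graph → 0 ≤ (inner ℂ v g).re)
    (hK₁ : S.T₁.HasCompactResolvent) (hK₂ : S.T₂.HasCompactResolvent)
    (hρ₃ : ∀ w ∈ (Complex.ofReal '' Set.Ici 0)ᶜ, w ∈ S.T₃.resolventSet)
    {z : ℂ} (hz : z ∈ (Complex.ofReal '' Set.Ici 0)ᶜ) (hzA : z ∈ S.A.spectrum) :
    S.A.IsIsolatedEigenvalueOfFiniteMultiplicity z := by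
  obtain ⟨z₁, hz₁, hK₁⟩ := hK₁
  obtain ⟨z₂, hz₂, hK₂⟩ := hK₂
  have h₁ := LinearPMap.resolvent_spec hz₁
  have h₂ := LinearPMap.resolvent_spec hz₂
  set R₁ := S.T₁.resolvent z₁
  set R₂ := S.T₂.resolvent z₂
  set R₃ := S.T₃.resolvent
  set U : Set ℂ := (Complex.ofReal '' Set.Ici 0)ᶜ with hU
  have hUo : IsOpen U := isOpen_compl_nonneg
  have h₃ : ∀ w ∈ U, S.T₃.IsResolventAt w (R₃ w) := fun w hw =>
    LinearPMap.resolvent_spec (hρ₃ w hw)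
  set G : ℂ → E →L[ℂ] E := fun w => S.perturbation z₁ z₂ w R₁ R₂ (R₃ w) with hG
  have hR₃ : ∀ w ∈ U, DifferentiableAt ℂ R₃ w := fun w hw =>
    LinearPMap.differentiableAt_resolvent (hρ₃ w hw)
  have hNd : ∀ w ∈ U, DifferentiableAt ℂ (fun w => S.nilPart (R₃ w)) w := fun w hw =>
    DifferentiableAt.clm_comp (differentiableAt_const _)
      ((hR₃ w hw).clm_comp (differentiableAt_const _))
  have hDd : ∀ w ∈ U, DifferentiableAt ℂ (fun w => S.diag R₁ R₂ (R₃ w)) w := fun w hw =>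
    DifferentiableAt.add (differentiableAt_const _)
      (DifferentiableAt.clm_comp (differentiableAt_const _)
        ((hR₃ w hw).clm_comp (differentiableAt_const _)))
  have hCd : Differentiable ℂ (fun w => S.compactPart z₁ z₂ w R₁ R₂) := by
    intro w
    have e : ∀ y : ℂ, DifferentiableAt ℂ (fun w : ℂ => y - w) w := fun y => by fun_prop
    refine DifferentiableAt.add ?_ ?_
    · exact DifferentiableAt.clm_comp (((e z₁).smul_const _).add_const _) (differentiableAt_const _)
    · exact DifferentiableAt.clm_comp (((e z₂).smul_const _).add_const _) (differentiableAt_const _)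
  have hGd : ∀ w ∈ U, DifferentiableAt ℂ G w := fun w hw =>
    ((hNd w hw).const_sub 1).mul (hCd w)
  have loc := fun w (hw : w ∈ U) => FredholmTheory.exists_local_inverse
    (Filter.eventually_of_mem (hUo.mem_nhds hw) hGd)
    (S.isCompactOperator_perturbation z₁ z₂ w (R₃ w) hK₁ hK₂)
  set bad : ℂ → Prop := fun w => ∃ x ≠ 0, (1 + G w) x = 0 with hbad
  have hnotbad : ∀ {w : ℂ} {d : ℂ} {Y : E →L[ℂ] E}, Y * (1 + G w) = d • 1 → d ≠ 0 → ¬ bad w := by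
    rintro w d Y hl hd ⟨x, hx, hx'⟩
    have := congrArg (fun T : E →L[ℂ] E => T x) hl
    simp only [mul_apply_eq_comp, hx', map_zero, smul_apply, one_apply_eq_self] at this
    exact (smul_ne_zero hd hx) this.symm
  have heig : ∀ w ∈ U, bad w → S.A.HasEigenvalue w := by
    rintro w hw ⟨x, hx, hx'⟩
    have hg := (S.eigenvector_iff h₁ h₂ (h₃ w hw) _).2 ⟨x, rfl, hx'⟩
    obtain ⟨v, hv, hv'⟩ := S.A.mem_graph_iff.1 hg
    refine ⟨v, ?_, by rw [hv', hv]⟩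
    rintro rfl
    exact hx (S.diag_injective h₁ h₂ (h₃ w hw) hv.symm)
  -- Injectivity at one point is enough to start the continuation, since `bad` concerns only null
  -- vectors.
  obtain ⟨t, ht, ht'⟩ := S.exists_neg_not_eigenvalue hT₁ hT₂ hT₃
  have htU : (-(t : ℂ)) ∈ U := by
    rintro ⟨x, hx, hx'⟩
    have := congrArg Complex.re hx'
    simp only [Complex.ofReal_re, Complex.neg_re] at this
    have hx0 : (0 : ℝ) ≤ x := hx
    linarith
  have htb : ¬ bad (-(t : ℂ)) := by
    rintro ⟨x, hx, hx'⟩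
    have hg := (S.eigenvector_iff h₁ h₂ (h₃ _ htU) _).2 ⟨x, rfl, hx'⟩
    exact hx (S.diag_injective h₁ h₂ (h₃ _ htU) (ht' _ hg))
  have hdich : ∀ w ∈ U, (∀ᶠ w' in 𝓝 w, bad w') ∨ ∀ᶠ w' in 𝓝[≠] w, ¬ bad w' := by
    intro w hw
    obtain ⟨d, Y, W, hd, -, -, -, hY⟩ := loc w hw
    rcases hd.eventually_eq_zero_or_eventually_ne_zero with h | h
    · left
      filter_upwards [h, hY] with w' h1 h2 using h2.2.2 h1
    · right
      filter_upwards [h, hY.filter_mono nhdsWithin_le_nhds] with w' h1 h2 using hnotbad h2.2.1 h1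
  have hgood := eventually_not_of_isPreconnected isPreconnected_compl_nonneg hdich htU htb hz
  obtain ⟨d, Y, W, hd, hYd, hW, hW', hY⟩ := loc z hz
  have hdz : d z = 0 := by
    by_contra h
    have hYz := hY.self_of_nhds
    exact hzA ⟨_, S.isResolventAt_of_inverse h₁ h₂ (h₃ z hz) h hYz.1 hYz.2.1⟩
  have hnz : ¬ ∀ᶠ w in 𝓝 z, d w = 0 := by
    intro h
    have h' : ∀ᶠ w in 𝓝[≠] z, bad w := by
      filter_upwards [(h.and hY).filter_mono nhdsWithin_le_nhds] with w hw using hw.2.2.2 hw.1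
    obtain ⟨w, hw1, hw2⟩ := (h'.and hgood).exists
    exact hw2 hw1
  -- The order `n` of the zero of `d` bounds the order of the pole of the resolvent.
  obtain ⟨n, q, hq, hqz, hdq⟩ := hd.exists_eventuallyEq_pow_smul_nonzero_iff.2 hnz
  have hqd : ∀ᶠ w in 𝓝 z, DifferentiableAt ℂ q w :=
    hq.eventually_analyticAt.mono fun w hw => hw.differentiableAt
  have hq0 : ∀ᶠ w in 𝓝 z, q w ≠ 0 := hq.continuousAt.eventually_ne hqz
  obtain ⟨ρ, hρ, hball⟩ := Metric.nhds_basis_closedBall.eventually_iff.1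
    (((hYd.and hY).and (hdq.and (hqd.and hq0))).and (hUo.mem_nhds hz))
  have hres : ∀ w ∈ Metric.closedBall z ρ, w ≠ z → S.A.IsResolventAt w
      (((w - z) ^ n * q w)⁻¹ • (S.diag R₁ R₂ (R₃ w) * Y w * (1 - S.nilPart (R₃ w)))) := by
    intro w hw hwz
    obtain ⟨⟨⟨-, hYw⟩, hdw, -, hq0w⟩, hwU⟩ := hball hw
    have hne : (w - z) ^ n * q w ≠ 0 := mul_ne_zero (pow_ne_zero _ (sub_ne_zero.2 hwz)) hq0w
    rw [smul_eq_mul] at hdw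
    rw [hdw] at hYw
    exact S.isResolventAt_of_inverse h₁ h₂ (h₃ w hwU) hne hYw.1 hYw.2.1
  have hsphere : ∀ w ∈ Metric.sphere z ρ, w ∈ Metric.closedBall z ρ ∧ w ≠ z := fun w hw =>
    ⟨Metric.sphere_subset_closedBall hw, Metric.ne_of_mem_sphere hw hρ.ne'⟩
  refine ⟨heig z hz (hY.self_of_nhds.2.2 hdz), ρ, hρ, fun w hw hwz => ⟨_, hres w hw hwz⟩, ?_⟩
  refine LinearPMap.finiteDimensional_range_rieszProjection hρ
    (fun w hw => ⟨_, hres w (hsphere w hw).1 (hsphere w hw).2⟩)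
    (N := W.map (S.diag R₁ R₂ (R₃ z)).toLinearMap) ?_ (n := n) ?_
  · intro u hu
    obtain ⟨x, hx, hx'⟩ := (S.eigenvector_iff h₁ h₂ (h₃ z hz) u).1 hu
    exact ⟨x, hW' x hx', hx⟩
  -- Multiplying by `(w - z)^n` leaves an integrand that extends analytically across `z`, so
  -- Cauchy's theorem gives the vanishing moment.
  · have hcongr : (∮ w in C(z, ρ), (w - z) ^ n • S.A.resolvent w) =
        ∮ w in C(z, ρ), (q w)⁻¹ • (S.diag R₁ R₂ (R₃ w) * Y w * (1 - S.nilPart (R₃ w))) := by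
      refine circleIntegral.integral_congr hρ.le fun w hw => ?_
      obtain ⟨hw1, hw2⟩ := hsphere w hw
      have hne : (w - z) ^ n ≠ 0 := pow_ne_zero _ (sub_ne_zero.2 hw2)
      simp only [(hres w hw1 hw2).resolvent_eq, smul_smul]
      rw [mul_inv, ← mul_assoc, mul_inv_cancel₀ hne, one_mul]
    rw [hcongr]
    refine DiffContOnCl.circleIntegral_eq_zero hρ.le (DifferentiableOn.diffContOnCl ?_)
    rw [closure_ball z hρ.ne']
    intro w hw
    obtain ⟨⟨⟨hYw, -⟩, -, hqw, hq0w⟩, hwU⟩ := hball hw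
    refine DifferentiableAt.differentiableWithinAt ?_
    exact (hqw.inv hq0w).smul (((hDd w hwU).mul hYw).mul ((hNd w hwU).const_sub 1))

end

end CoupledSystem
end

/-! ### Closures of operators, and density of test functions for the Laplacian -/

noncomputable section

namespace LinearPMap

open Filter Topology

variable {H : Type*} [NormedAddCommGroup H] [NormedSpace ℂ H]

/-- No closability is needed: by convention the closure of a non-closable operator is the operator
itself. -/
theorem closure_graph_subset (B : H →ₗ.[ℂ] H) {P : Set (H × H)} (hP : _root_.IsClosed P)
    (h : (B.graph : Set (H × H)) ⊆ P) : (B.closure.graph : Set (H × H)) ⊆ P := by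
  by_cases hB : B.IsClosable
  · rw [← hB.graph_closure_eq_closure_graph, Submodule.topologicalClosure_coe]
    exact closure_minimal h hP
  · rwa [closure_def' hB]

/-- A bounded injective left inverse of `B - z` is the resolvent of the closure of `B` at `z` when
`B - z` has dense range. -/
theorem isResolventAt_closure {B : H →ₗ.[ℂ] H} {z : ℂ} {R : H →L[ℂ] H}
    (hinj : ∀ f, R f = 0 → f = 0) (hleft : ∀ u : B.domain, R (B u - z • (u : H)) = u)
    (hdense : DenseRange fun u : B.domain => B u - z • (u : H)) :
    B.closure.IsResolventAt z R := by
  have hsub : (B.graph : Set (H × H)) ⊆ {p | R (p.2 - z • p.1) = p.1} := by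
    rintro ⟨u, g⟩ hp
    obtain ⟨v, hv, hv'⟩ := B.mem_graph_iff.1 hp
    simp only at hv hv'
    rw [Set.mem_ofPred_eq, ← hv, ← hv']
    exact hleft v
  have hclosed : _root_.IsClosed {p : H × H | R (p.2 - z • p.1) = p.1} :=
    isClosed_eq (by fun_prop) continuous_fst
  -- Every solution is the image of some `f` under `f ↦ (R f, f + z R f)`, and this continuous map
  -- sends the dense range of `B - z` into the graph.
  have hcl : ∀ p : H × H, p ∈ B.graph.topologicalClosure ↔ R (p.2 - z • p.1) = p.1 := by
    intro p
    constructor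
    · intro hp
      exact closure_minimal hsub hclosed hp
    · intro hp
      have hc : Continuous fun f : H => (R f, f + z • R f) := by fun_prop
      have h1 := map_mem_closure (t := (B.graph : Set (H × H))) hc (hdense (p.2 - z • p.1)) (by
        rintro _ ⟨u, rfl⟩
        simp only [hleft, sub_add_cancel]
        exact B.mem_graph u)
      simp only [hp, sub_add_cancel] at h1
      exact h1
  have hBc : B.IsClosable := by
    refine ⟨B.graph.topologicalClosure.toLinearPMap, ?_⟩
    rw [Submodule.toLinearPMap_graph_eq]
    intro p hp h0
    have := (hcl p).1 hp
    rw [h0, smul_zero, sub_zero] at this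
    exact hinj _ this
  rw [isResolventAt_iff]
  intro u g
  rw [← hBc.graph_closure_eq_closure_graph]
  exact hcl (u, g)

end LinearPMap

namespace BlochTorrey

open Filter Topology SchwartzMap FourierTransform

variable {k : ℕ}

theorem fourier_laplacian_apply (f : 𝓢(Space k, ℂ)) (x : Space k) :
    𝓕 (Δ f) x = (-((2 * Real.pi) ^ 2 * ‖x‖ ^ 2) : ℝ) • 𝓕 f x := by
  rw [SchwartzMap.laplacian_eq_fourierMultiplierCLM, FourierTransform.fourier_smul,
    SchwartzMap.fourierMultiplierCLM_apply, FourierTransform.fourier_fourierInv_eq, smul_apply,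
    SchwartzMap.smulLeftCLM_apply_apply (by fun_prop)]
  simp [mul_assoc]

/-- The exponent `k + 1` exceeds the dimension, so the weight is integrable; being at most 1, it
also dominates its own square. -/
theorem tendsto_toLp_of_dominated {f : ℕ → 𝓢(Space k, ℂ)} {g : 𝓢(Space k, ℂ)} {C : ℝ}
    (hbound : ∀ n x, ‖f n x‖ ≤ C * (1 + ‖x‖) ^ (-((k : ℝ) + 1)))
    (hlim : ∀ x, ∀ᶠ n in atTop, f n x = g x) :
    Tendsto (fun n => (f n).toLp 2) atTop (𝓝 (g.toLp 2 : L2 k ℂ)) := by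
  set b : Space k → ℝ := fun x => (1 + ‖x‖) ^ (-((k : ℝ) + 1)) with hb
  have hb0 : ∀ x, 0 ≤ b x := fun x => Real.rpow_nonneg (by positivity) _
  have hb1 : ∀ x, b x ≤ 1 := fun x => by
    have h0 := norm_nonneg x
    exact Real.rpow_le_one_of_one_le_of_nonpos (by linarith)
      (by have : (0 : ℝ) ≤ k := Nat.cast_nonneg k; linarith)
  have hbi : Integrable b := integrable_one_add_norm (by simp)
  have hC : 0 ≤ C := by
    have h1 := (norm_nonneg _).trans (hbound 0 0)
    simpa using h1
  have hg : ∀ x, ‖g x‖ ≤ C * b x := by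
    intro x
    obtain ⟨n, hn⟩ := (hlim x).exists
    rw [← hn]
    exact hbound n x
  have hsub : ∀ n, (f n).toLp 2 volume - g.toLp 2 volume = (f n - g).toLp 2 volume := fun n =>
    ((toLpCLM ℂ ℂ 2 (volume : Measure (Space k))).map_sub (f n) g).symm
  rw [tendsto_iff_norm_sub_tendsto_zero]
  simp only [hsub, norm_toLp' (two_ne_zero) (ENNReal.ofNat_ne_top)]
  have h0 : Tendsto (fun n => ∫ x : Space k, ‖(f n - g) x‖ ^ (2 : ℝ≥0∞).toReal) atTop (𝓝 0) := by
    have h := tendsto_integral_of_dominated_convergence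
      (F := fun n (x : Space k) => ‖(f n - g) x‖ ^ (2 : ℝ≥0∞).toReal) (f := fun _ => (0 : ℝ))
      (μ := volume) (fun x => (2 * C) ^ 2 * b x) ?_ (hbi.const_mul _) ?_ ?_
    · simpa using h
    · intro n
      simp only [ENNReal.toReal_ofNat, Real.rpow_ofNat]
      exact ((f n - g).continuous.norm.pow 2).aestronglyMeasurable
    · intro n
      refine Eventually.of_forall fun x => ?_
      simp only [ENNReal.toReal_ofNat, Real.rpow_ofNat, _root_.sub_apply, norm_pow, norm_norm]
      have h1 : ‖f n x - g x‖ ≤ 2 * C * b x := by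
        have := norm_sub_le (f n x) (g x)
        have h2 := hbound n x
        have h3 := hg x
        simp only [hb] at h3 ⊢
        linarith
      calc ‖f n x - g x‖ ^ 2 ≤ (2 * C * b x) ^ 2 := by gcongr
        _ = (2 * C) ^ 2 * (b x * b x) := by ring
        _ ≤ (2 * C) ^ 2 * (b x * 1) := by
          refine mul_le_mul_of_nonneg_left ?_ (by positivity)
          exact mul_le_mul_of_nonneg_left (hb1 x) (hb0 x)
        _ = _ := by ring
    · refine Eventually.of_forall fun x => ?_
      refine tendsto_const_nhds.congr' ?_
      filter_upwards [hlim x] with n hn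
      simp [hn]
  have h2 := h0.rpow_const (p := (2 : ℝ≥0∞).toReal⁻¹) (Or.inr (by simp))
  simpa using h2

theorem norm_laplacian_le (f : Space k → ℂ) (x : Space k) :
    ‖(Δ f) x‖ ≤ k * ‖iteratedFDeriv ℝ 2 f x‖ := by
  rw [InnerProductSpace.laplacian_eq_iteratedFDeriv_orthonormalBasis f
    (EuclideanSpace.basisFun (Fin k) ℝ)]
  refine (norm_sum_le _ _).trans ?_
  have : ∀ i ∈ (Finset.univ : Finset (Fin k)), ‖(iteratedFDeriv ℝ 2 f x)
      ![EuclideanSpace.basisFun (Fin k) ℝ i, EuclideanSpace.basisFun (Fin k) ℝ i]‖ ≤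
      ‖iteratedFDeriv ℝ 2 f x‖ := by
    intro i _
    refine (ContinuousMultilinearMap.le_opNorm _ _).trans ?_
    simp [Fin.prod_univ_two]
  refine (Finset.sum_le_sum this).trans ?_
  simp

theorem iteratedFDeriv_decay (u : 𝓢(Space k, ℂ)) (n : ℕ) :
    ∃ C, 0 ≤ C ∧ ∀ x, ‖iteratedFDeriv ℝ n u x‖ ≤ C * (1 + ‖x‖) ^ (-((k : ℝ) + 1)) := by
  set C := 2 ^ (k + 1) * (Finset.Iic (k + 1, n)).sup
    (fun m => SchwartzMap.seminorm ℝ m.1 m.2) u with hC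
  refine ⟨C, by positivity, fun x => ?_⟩
  have h := one_add_le_sup_seminorm_apply (𝕜 := ℝ) (m := (k + 1, n)) le_rfl le_rfl u x
  have hpos : (0 : ℝ) < (1 + ‖x‖) ^ (k + 1) := by positivity
  have e : (1 + ‖x‖) ^ (-((k : ℝ) + 1)) = ((1 + ‖x‖) ^ (k + 1))⁻¹ := by
    rw [Real.rpow_neg (by positivity)]
    congr 1
    exact_mod_cast Real.rpow_natCast (1 + ‖x‖) (k + 1)
  rw [e, ← div_eq_mul_inv, le_div_iff₀ hpos, mul_comm]
  exact h

/-- A smooth function that is `1` on the ball of radius `n + 1` and has compact support. -/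
def cutoff (k n : ℕ) (x : Space k) : ℝ :=
  (⟨1, 2, one_pos, one_lt_two⟩ : ContDiffBump (0 : Space k)) (((n : ℝ) + 1)⁻¹ • x)

theorem contDiff_cutoff (k n : ℕ) : ContDiff ℝ ∞ (cutoff k n) :=
  (ContDiffBump.contDiff _).comp (contDiff_const_smul _)

theorem hasCompactSupport_cutoff (k n : ℕ) : HasCompactSupport (cutoff k n) :=
  (ContDiffBump.hasCompactSupport _).comp_smul (by positivity)

theorem cutoff_eventuallyEq (k : ℕ) (x : Space k) :
    ∀ᶠ n in atTop, cutoff k n =ᶠ[𝓝 x] fun _ => 1 := by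
  obtain ⟨N, hN⟩ := exists_nat_gt ‖x‖
  filter_upwards [eventually_ge_atTop N] with n hn
  have hlt : ‖x‖ < (n : ℝ) + 1 := by
    have : (N : ℝ) ≤ n := by exact_mod_cast hn
    linarith
  filter_upwards [(isOpen_lt continuous_norm continuous_const).mem_nhds hlt] with y hy
  refine ContDiffBump.one_of_mem_closedBall _ ?_
  rw [mem_closedBall_zero_iff, norm_smul, norm_inv, Real.norm_of_nonneg (by positivity),
    inv_mul_le_iff₀ (by positivity), mul_one]
  exact le_of_lt hy

/-- Each cutoff is one bump composed with a dilation of norm at most 1, so derivatives stay bounded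
uniformly in `n`. -/
theorem exists_norm_iteratedFDeriv_cutoff_le (k i : ℕ) :
    ∃ C, 0 ≤ C ∧ ∀ n x, ‖iteratedFDeriv ℝ i (cutoff k n) x‖ ≤ C := by
  set χ : ContDiffBump (0 : Space k) := ⟨1, 2, one_pos, one_lt_two⟩ with hχ
  have hχd : ContDiff ℝ ∞ χ := χ.contDiff
  have hi : ((i : ℕ∞) : WithTop ℕ∞) ≤ ((⊤ : ℕ∞) : WithTop ℕ∞) := by exact_mod_cast le_top
  obtain ⟨C, hC⟩ := (χ.hasCompactSupport.iteratedFDeriv (𝕜 := ℝ) i).exists_bound_of_continuous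
    (hχd.continuous_iteratedFDeriv hi)
  refine ⟨C, (norm_nonneg _).trans (hC 0), fun n x => ?_⟩
  set L : Space k →L[ℝ] Space k := ((n : ℝ) + 1)⁻¹ • ContinuousLinearMap.id ℝ (Space k) with hL
  have hL1 : ‖L‖ ≤ 1 := by
    refine ContinuousLinearMap.opNorm_le_bound _ zero_le_one fun y => ?_
    rw [hL, smul_apply, ContinuousLinearMap.id_apply, norm_smul]
    gcongr
    rw [norm_inv, Real.norm_of_nonneg (by positivity)]
    exact inv_le_one_of_one_le₀ (by linarith [Nat.cast_nonneg (α := ℝ) n])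
  have e : cutoff k n = χ ∘ L := by
    ext y
    simp [cutoff, hL, hχ]
  rw [e, L.iteratedFDeriv_comp_right hχd x hi]
  refine (ContinuousMultilinearMap.norm_compContinuousLinearMap_le _ _).trans ?_
  rw [Finset.prod_const]
  calc _ ≤ C * 1 := by
        gcongr
        · exact (norm_nonneg _).trans (hC 0)
        · exact hC _
        · exact pow_le_one₀ (norm_nonneg _) hL1
    _ = C := mul_one C

theorem exists_norm_iteratedFDeriv_cutoff_smul_le (u : 𝓢(Space k, ℂ)) (j : ℕ) :
    ∃ C, ∀ n x, ‖iteratedFDeriv ℝ j (fun y => cutoff k n y • u y) x‖ ≤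
      C * (1 + ‖x‖) ^ (-((k : ℝ) + 1)) := by
  choose A hA0 hA using exists_norm_iteratedFDeriv_cutoff_le k
  choose B hB0 hB using iteratedFDeriv_decay u
  refine ⟨∑ i ∈ Finset.range (j + 1), (j.choose i : ℝ) * A i * B (j - i), fun n x => ?_⟩
  refine (norm_iteratedFDeriv_smul_le (N := ∞) (contDiff_cutoff k n) (u.smooth _) x
    (by exact_mod_cast le_top)).trans ?_
  rw [Finset.sum_mul]
  refine Finset.sum_le_sum fun i _ => ?_
  calc (j.choose i : ℝ) * ‖iteratedFDeriv ℝ i (cutoff k n) x‖ * ‖iteratedFDeriv ℝ (j - i) u x‖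
      ≤ (j.choose i : ℝ) * A i * (B (j - i) * (1 + ‖x‖) ^ (-((k : ℝ) + 1))) := by
        gcongr
        · exact mul_nonneg (Nat.cast_nonneg _) (hA0 i)
        · exact hA i n x
        · exact hB _ x
    _ = _ := by ring

/-- The graph of `-Δ` on Schwartz functions lies in the closure of its graph on `C₀^∞`. -/
theorem toLp_mem_closure_testGraph (u : 𝓢(Space k, ℂ)) :
    ((u.toLp 2, (-Δ u).toLp 2) : L2 k ℂ × L2 k ℂ) ∈
      closure (testGraph (fun x : Space k => LinearMap.mulLeft ℂ ((fun _ => (0 : ℂ)) x)) :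
        Set (L2 k ℂ × L2 k ℂ)) := by
  have hcs : ∀ n, HasCompactSupport fun y => cutoff k n y • u y := fun n =>
    (hasCompactSupport_cutoff k n).smul_right
  have hcd : ∀ n, ContDiff ℝ ∞ fun y => cutoff k n y • u y := fun n =>
    (contDiff_cutoff k n).smul (u.smooth _)
  set v : ℕ → 𝓢(Space k, ℂ) := fun n => (hcs n).toSchwartzMap (hcd n) with hv
  have hvc : ∀ n, (v n : Space k → ℂ) = fun y => cutoff k n y • u y := fun n => rfl
  -- Equality near `x`, not just at `x`, so that the Laplacians agree as well.
  have hev : ∀ x, ∀ᶠ n in atTop, (v n : Space k → ℂ) =ᶠ[𝓝 x] u := by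
    intro x
    filter_upwards [cutoff_eventuallyEq k x] with n hn
    filter_upwards [hn] with y hy
    simp [hvc, hy]
  obtain ⟨C₀, hC₀⟩ := exists_norm_iteratedFDeriv_cutoff_smul_le u 0
  obtain ⟨C₂, hC₂⟩ := exists_norm_iteratedFDeriv_cutoff_smul_le u 2
  have t1 : Tendsto (fun n => (v n).toLp 2) atTop (𝓝 (u.toLp 2 : L2 k ℂ)) := by
    refine tendsto_toLp_of_dominated (C := C₀) (fun n x => ?_) fun x => ?_
    · have := hC₀ n x
      rwa [norm_iteratedFDeriv_zero] at this
    · filter_upwards [hev x] with n hn using hn.self_of_nhds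
  have t2 : Tendsto (fun n => (-Δ (v n)).toLp 2) atTop (𝓝 ((-Δ u).toLp 2 : L2 k ℂ)) := by
    refine tendsto_toLp_of_dominated (C := k * C₂) (fun n x => ?_) fun x => ?_
    · rw [_root_.neg_apply, norm_neg, SchwartzMap.laplacian_apply]
      refine (norm_laplacian_le _ x).trans ?_
      rw [mul_assoc]
      exact mul_le_mul_of_nonneg_left (hC₂ n x) (Nat.cast_nonneg k)
    · filter_upwards [hev x] with n hn
      rw [_root_.neg_apply, _root_.neg_apply, SchwartzMap.laplacian_apply,
        SchwartzMap.laplacian_apply]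
      rw [(InnerProductSpace.laplacian_congr_nhds hn).self_of_nhds]
  refine mem_closure_of_tendsto (t1.prodMk_nhds t2) (Eventually.of_forall fun n => ?_)
  refine ⟨v n, hcd n, hcs n, (v n).coeFn_toLp 2 volume, ?_⟩
  filter_upwards [(-Δ (v n)).coeFn_toLp 2 volume] with x hx
  rw [hx, _root_.neg_apply, SchwartzMap.laplacian_apply]
  simp

end BlochTorrey
end

/-! ### The free resolvent as a Fourier multiplier -/

noncomputable section

namespace BlochTorrey

open Filter Topology SchwartzMap FourierTransform

variable {k : ℕ}

theorem graph_testGraph {F : Type*} [NormedAddCommGroup F] [NormedSpace ℝ F] [NormedSpace ℂ F]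
    (V : Space k → F →ₗ[ℂ] F) : (testGraph V).toLinearPMap.graph = testGraph V :=
  Submodule.toLinearPMap_graph_eq _ (testGraph_single_valued V)

theorem coeFn_mulOp (c : Space k → ℂ) (hc : MemLp c ∞ volume) (f : L2 k ℂ) :
    mulOp c hc f =ᵐ[volume] fun x => c x * f x := by
  have h := (ContinuousLinearMap.mul ℂ ℂ).coeFn_holder (r := 2) (hc.toLp c) f
  filter_upwards [h, hc.coeFn_toLp] with x h1 h2
  exact h1.trans (by rw [h2]; rfl)

/-- The Fourier symbol of the resolvent of `-Δ`. -/
def resolventSymbol (z : ℂ) (ξ : Space k) : ℂ := ((((2 * Real.pi) ^ 2 * ‖ξ‖ ^ 2 : ℝ) : ℂ) - z)⁻¹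

section

variable {z : ℂ} (hz : z ∈ (Complex.ofReal '' Set.Ici 0)ᶜ)
include hz

theorem symbol_sub_ne_zero (ξ : Space k) : (((2 * Real.pi) ^ 2 * ‖ξ‖ ^ 2 : ℝ) : ℂ) - z ≠ 0 := by
  intro h
  exact hz ⟨_, by rw [Set.mem_Ici]; positivity, sub_eq_zero.1 h⟩

theorem contDiff_resolventSymbol : ContDiff ℝ ∞ (resolventSymbol (k := k) z) := by
  refine ContDiff.inv ?_ (symbol_sub_ne_zero hz)
  refine ContDiff.sub ?_ contDiff_const
  exact Complex.ofRealCLM.contDiff.comp (contDiff_const.mul (contDiff_norm_sq ℝ))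

/-- The symbol is bounded by `δ⁻¹`, where a `δ`-ball about `z` misses the half-line. -/
theorem memLp_resolventSymbol :
    MemLp (resolventSymbol (k := k) z) ∞ (volume : Measure (Space k)) := by
  obtain ⟨δ, hδ, hball⟩ := Metric.isOpen_iff.1 CoupledSystem.isOpen_compl_nonneg z hz
  refine memLp_top_of_bound (contDiff_resolventSymbol hz).continuous.aestronglyMeasurable δ⁻¹
    (Eventually.of_forall fun ξ => ?_)
  rw [resolventSymbol, norm_inv]
  refine inv_anti₀ hδ ?_
  by_contra h
  rw [not_le, ← dist_eq_norm] at h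
  exact hball (Metric.mem_ball.2 h) ⟨_, by rw [Set.mem_Ici]; positivity, rfl⟩

/-- The bounded operator `(-Δ - z)⁻¹`, as a Fourier multiplier. -/
def freeResolvent : L2 k ℂ →L[ℂ] L2 k ℂ :=
  (Lp.fourierTransformₗᵢ (Space k) ℂ).symm.toContinuousLinearEquiv.toContinuousLinearMap ∘L
    mulOp (resolventSymbol z) (memLp_resolventSymbol hz) ∘L
      (Lp.fourierTransformₗᵢ (Space k) ℂ).toContinuousLinearEquiv.toContinuousLinearMap

theorem freeResolvent_apply (f : L2 k ℂ) : freeResolvent hz f =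
    𝓕⁻ (mulOp (resolventSymbol z) (memLp_resolventSymbol hz) (𝓕 f)) := rfl

theorem freeResolvent_injective {f : L2 k ℂ} (hf : freeResolvent hz f = 0) : f = 0 := by
  rw [freeResolvent_apply] at hf
  have h1 : mulOp (resolventSymbol z) (memLp_resolventSymbol hz) (𝓕 f) = 0 :=
    (Lp.fourierTransformₗᵢ (Space k) ℂ).symm.map_eq_zero_iff.1 hf
  have h2 := coeFn_mulOp (resolventSymbol z) (memLp_resolventSymbol hz) (𝓕 f)
  rw [h1] at h2
  have h3 : (𝓕 f : L2 k ℂ) = 0 := by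
    refine Lp.ext ?_
    filter_upwards [h2, Lp.coeFn_zero ℂ 2 (volume : Measure (Space k))] with x h2 h3
    rw [h3] at h2 ⊢
    exact ((mul_eq_zero.1 h2.symm).resolve_left (inv_ne_zero (symbol_sub_ne_zero hz x)))
  exact (Lp.fourierTransformₗᵢ (Space k) ℂ).map_eq_zero_iff.1 h3

omit hz in
theorem fourier_neg_laplacian_sub (z : ℂ) (u : 𝓢(Space k, ℂ)) (x : Space k) :
    𝓕 (-Δ u - z • u) x = ((((2 * Real.pi) ^ 2 * ‖x‖ ^ 2 : ℝ) : ℂ) - z) * 𝓕 u x := by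
  have e : -Δ u - z • u = (-1 : ℂ) • Δ u + (-z) • u := by module
  rw [e, FourierTransform.fourier_add, FourierTransform.fourier_smul,
    FourierTransform.fourier_smul, _root_.add_apply, _root_.smul_apply, _root_.smul_apply,
    fourier_laplacian_apply, Complex.real_smul, smul_eq_mul, smul_eq_mul, Complex.ofReal_neg]
  ring

omit hz in
theorem toLp_neg_laplacian_sub (z : ℂ) (u : 𝓢(Space k, ℂ)) :
    (-Δ u).toLp 2 volume - z • u.toLp 2 volume = (-Δ u - z • u).toLp 2 volume := by
  have h1 := (toLpCLM ℂ ℂ 2 (volume : Measure (Space k))).map_sub (-Δ u) (z • u)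
  have h2 := (toLpCLM ℂ ℂ 2 (volume : Measure (Space k))).map_smul z u
  rw [h2] at h1
  exact h1.symm

theorem freeResolvent_toLp (u : 𝓢(Space k, ℂ)) :
    freeResolvent hz ((-Δ u).toLp 2 volume - z • u.toLp 2 volume) = u.toLp 2 volume := by
  rw [toLp_neg_laplacian_sub, freeResolvent_apply, SchwartzMap.toLp_fourier_eq]
  have h : mulOp (resolventSymbol z) (memLp_resolventSymbol hz)
      ((𝓕 (-Δ u - z • u)).toLp 2 volume) = 𝓕 (u.toLp 2 volume) := by
    rw [SchwartzMap.toLp_fourier_eq]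
    refine Lp.ext ?_
    filter_upwards [coeFn_mulOp (resolventSymbol z) (memLp_resolventSymbol hz)
      ((𝓕 (-Δ u - z • u)).toLp 2 volume), (𝓕 (-Δ u - z • u)).coeFn_toLp 2 volume,
      (𝓕 u).coeFn_toLp 2 volume] with x h1 h2 h3
    rw [h1, h2, h3, fourier_neg_laplacian_sub, resolventSymbol, ← mul_assoc,
      inv_mul_cancel₀ (symbol_sub_ne_zero hz x), one_mul]
  rw [h, FourierTransform.fourierInv_fourier_eq]

/-- The multiplier inverts `-Δ - z` on test functions, so only density of the range remains. Vectors
with test-function Fourier transform `ψ` are dense, and each is `(-Δ - z) u` for the Schwartz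
function `u` with transform `ψ` times the symbol; Schwartz functions lie in the graph closure. -/
theorem isResolventAt_freeResolvent :
    (scalarOp (k := k) fun _ => 0).IsResolventAt z (freeResolvent hz) := by
  set V : Space k → ℂ →ₗ[ℂ] ℂ := fun x => LinearMap.mulLeft ℂ ((fun _ => (0 : ℂ)) x) with hV
  change (testGraph V).toLinearPMap.closure.IsResolventAt z (freeResolvent hz)
  set B := (testGraph V).toLinearPMap with hB
  have hBg : B.graph = testGraph V := graph_testGraph V
  refine LinearPMap.isResolventAt_closure (fun f => freeResolvent_injective hz) ?_ ?_
  · intro v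
    have hv := B.mem_graph v
    rw [hBg] at hv
    obtain ⟨u, hu, hu', h1, h2⟩ := hv
    set w := hu'.toSchwartzMap hu with hw
    have hwu : (w : Space k → ℂ) = u := rfl
    have e1 : (v : L2 k ℂ) = w.toLp 2 volume :=
      Lp.ext (h1.trans (w.coeFn_toLp 2 volume).symm)
    have e2 : B v = (-Δ w).toLp 2 volume := by
      refine Lp.ext (h2.trans ?_)
      filter_upwards [(-Δ w).coeFn_toLp 2 volume] with x hx
      rw [hx, _root_.neg_apply, SchwartzMap.laplacian_apply, hwu]
      simp [hV]
    rw [e1, e2]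
    exact freeResolvent_toLp hz w
  · have hS : ∀ u : 𝓢(Space k, ℂ), (-Δ u - z • u).toLp 2 volume ∈
        closure (Set.range fun v : B.domain => B v - z • (v : L2 k ℂ)) := by
      intro u
      have hc : Continuous fun p : L2 k ℂ × L2 k ℂ => p.2 - z • p.1 := by fun_prop
      have h := map_mem_closure (t := Set.range fun v : B.domain => B v - z • (v : L2 k ℂ)) hc
        (toLp_mem_closure_testGraph u) (by
          rintro p hp
          have hp' : p ∈ B.graph := by rw [hBg]; exact hp
          obtain ⟨v, hv, hv'⟩ := B.mem_graph_iff.1 hp'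
          exact ⟨v, by simp only [hv, hv']⟩)
      rwa [toLp_neg_laplacian_sub] at h
    intro f
    have hd := Lp.dense_hasCompactSupport_contDiff (E := Space k) (F := ℂ) (μ := volume) (p := 2)
      ENNReal.ofNat_ne_top (𝓕 f)
    have hc : Continuous fun g : L2 k ℂ => 𝓕⁻ g :=
      (Lp.fourierTransformₗᵢ (Space k) ℂ).symm.continuous
    have h := map_mem_closure (t := closure (Set.range fun v : B.domain => B v - z • (v : L2 k ℂ)))
      hc hd ?_
    · rwa [closure_closure, FourierTransform.fourierInv_fourier_eq] at h
    · rintro g ⟨ψ, hg, hψ, hψ'⟩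
      set w := (hψ.mul_left (f := resolventSymbol (k := k) z)).toSchwartzMap
        ((contDiff_resolventSymbol hz).mul hψ') with hw
      have e : 𝓕⁻ g = (-Δ (𝓕⁻ w) - z • (𝓕⁻ w)).toLp 2 volume := by
        have e' : g = 𝓕 ((-Δ (𝓕⁻ w) - z • (𝓕⁻ w)).toLp 2 volume) := by
          rw [SchwartzMap.toLp_fourier_eq]
          refine Lp.ext (hg.trans ?_)
          filter_upwards [(𝓕 (-Δ (𝓕⁻ w) - z • (𝓕⁻ w))).coeFn_toLp 2 volume] with x hx
          rw [hx, fourier_neg_laplacian_sub, FourierTransform.fourier_fourierInv_eq]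
          change ψ x = _ * (resolventSymbol z x * ψ x)
          rw [resolventSymbol, ← mul_assoc, mul_inv_cancel₀ (symbol_sub_ne_zero hz x), one_mul]
        rw [e', FourierTransform.fourierInv_fourier_eq]
      change 𝓕⁻ g ∈ _
      rw [e]
      exact hS _

theorem mem_resolventSet_free : z ∈ (scalarOp (k := k) fun _ => 0).resolventSet :=
  ⟨_, isResolventAt_freeResolvent hz⟩

end

/-! ### Accretivity -/

/-- By Plancherel this is the integral of `(2π‖ξ‖)² |û(ξ)|²`. -/
theorem re_inner_neg_laplacian_nonneg (u : 𝓢(Space k, ℂ)) :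
    0 ≤ (inner ℂ (u.toLp 2 volume) ((-Δ u).toLp 2 volume)).re := by
  rw [← Lp.inner_fourier_eq, SchwartzMap.toLp_fourier_eq, SchwartzMap.toLp_fourier_eq,
    L2.inner_def]
  have hint := L2.integrable_inner (𝕜 := ℂ) ((𝓕 u).toLp 2 volume) ((𝓕 (-Δ u)).toLp 2 volume)
  refine le_of_le_of_eq ?_ (integral_re hint)
  refine integral_nonneg_of_ae ?_
  filter_upwards [(𝓕 u).coeFn_toLp 2 volume, (𝓕 (-Δ u)).coeFn_toLp 2 volume] with x h1 h2
  have h3 := fourier_neg_laplacian_sub 0 u x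
  rw [zero_smul, sub_zero, sub_zero] at h3
  rw [h1, h2, h3, ← smul_eq_mul, inner_smul_right, inner_self_eq_norm_sq_to_K]
  change 0 ≤ (((_ : ℝ) : ℂ) * ((‖𝓕 u x‖ : ℝ) : ℂ) ^ 2).re
  rw [← Complex.ofReal_pow, ← Complex.ofReal_mul, Complex.ofReal_re]
  positivity

theorem re_inner_nonneg_of_mem_graph {q : Space k → ℂ} (hq : ∀ x, (q x).re = 0) (v g : L2 k ℂ)
    (h : (v, g) ∈ (scalarOp q).graph) : 0 ≤ (inner ℂ v g).re := by
  have hcl : IsClosed {p : L2 k ℂ × L2 k ℂ | 0 ≤ (inner ℂ p.1 p.2).re} :=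
    isClosed_le continuous_const (Complex.continuous_re.comp (by fun_prop))
  refine LinearPMap.closure_graph_subset _ hcl ?_ h
  rw [graph_testGraph]
  rintro ⟨v, g⟩ ⟨u, hu, hu', h1, h2⟩
  simp only at h1 h2
  set w := hu'.toSchwartzMap hu with hw
  have hwu : (w : Space k → ℂ) = u := rfl
  have e1 : v = w.toLp 2 volume := Lp.ext (h1.trans (w.coeFn_toLp 2 volume).symm)
  -- The difference represents `q u`, so it is in `L²` although `q` itself is not assumed
  -- measurable; its pairing with `u` is imaginary.
  have e2 : (inner ℂ v (g - (-Δ w).toLp 2 volume)).re = 0 := by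
    rw [L2.inner_def]
    have hint := L2.integrable_inner (𝕜 := ℂ) v (g - (-Δ w).toLp 2 volume)
    refine (integral_re hint).symm.trans (integral_eq_zero_of_ae ?_)
    filter_upwards [h1, h2, Lp.coeFn_sub g ((-Δ w).toLp 2 volume),
      (-Δ w).coeFn_toLp 2 volume] with x h1 h2 h3 h4
    have e3 : (g - (-Δ w).toLp 2 volume : L2 k ℂ) x = q x * u x := by
      rw [h3, Pi.sub_apply, h2, h4, _root_.neg_apply, SchwartzMap.laplacian_apply, hwu]
      simp
    rw [h1, e3, ← smul_eq_mul, inner_smul_right, inner_self_eq_norm_sq_to_K]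
    change (q x * ((‖u x‖ : ℝ) : ℂ) ^ 2).re = 0
    rw [← Complex.ofReal_pow, Complex.re_mul_ofReal, hq, zero_mul]
  rw [Set.mem_ofPred_eq]
  simp only
  have e4 : g = (-Δ w).toLp 2 volume + (g - (-Δ w).toLp 2 volume) := by abel
  rw [e4, inner_add_right, Complex.add_re, e2, add_zero, e1]
  exact re_inner_neg_laplacian_nonneg w

end BlochTorrey
end

noncomputable section

namespace BlochTorrey

open Filter Topology

variable {k : ℕ}

/-! ### Diagonalization of `u ↦ e₃ × u` -/

/-- `ℂ³`. -/
abbrev C3 : Type := EuclideanSpace ℂ (Fin 3)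

/-- The coordinate of `u ∈ ℂ³` along `(1, -i, 0) / √2`. -/
def coord₁ : C3 →L[ℂ] ℂ :=
  ((Real.sqrt 2 : ℂ)⁻¹) • (EuclideanSpace.proj 0 + Complex.I • EuclideanSpace.proj 1)

/-- The coordinate of `u ∈ ℂ³` along `(1, i, 0) / √2`. -/
def coord₂ : C3 →L[ℂ] ℂ :=
  ((Real.sqrt 2 : ℂ)⁻¹) • (EuclideanSpace.proj 0 - Complex.I • EuclideanSpace.proj 1)

/-- The third coordinate of `u ∈ ℂ³`. -/
def coord₃ : C3 →L[ℂ] ℂ := EuclideanSpace.proj 2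

/-- `a ↦ a (1, -i, 0) / √2`. -/
def embed₁ : ℂ →L[ℂ] C3 :=
  (1 : ℂ →L[ℂ] ℂ).smulRight
    (!₂[(Real.sqrt 2 : ℂ)⁻¹, -(Complex.I * (Real.sqrt 2 : ℂ)⁻¹), 0] : C3)

/-- `a ↦ a (1, i, 0) / √2`. -/
def embed₂ : ℂ →L[ℂ] C3 :=
  (1 : ℂ →L[ℂ] ℂ).smulRight
    (!₂[(Real.sqrt 2 : ℂ)⁻¹, Complex.I * (Real.sqrt 2 : ℂ)⁻¹, 0] : C3)

/-- `a ↦ a (0, 0, 1)`. -/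
def embed₃ : ℂ →L[ℂ] C3 := (1 : ℂ →L[ℂ] ℂ).smulRight (!₂[0, 0, 1] : C3)

theorem coord₁_apply (u : C3) : coord₁ u = (Real.sqrt 2 : ℂ)⁻¹ * (u 0 + Complex.I * u 1) := rfl

theorem coord₂_apply (u : C3) : coord₂ u = (Real.sqrt 2 : ℂ)⁻¹ * (u 0 - Complex.I * u 1) := rfl

theorem coord₃_apply (u : C3) : coord₃ u = u 2 := rfl

theorem sqrt_two_inv_mul_self : (Real.sqrt 2 : ℂ)⁻¹ * (Real.sqrt 2 : ℂ)⁻¹ = 1 / 2 := by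
  rw [← mul_inv, ← Complex.ofReal_mul, Real.mul_self_sqrt (by norm_num)]
  norm_num

theorem coord_embed (a : ℂ) :
    (coord₁ (embed₁ a) = a ∧ coord₁ (embed₂ a) = 0 ∧ coord₁ (embed₃ a) = 0) ∧
    (coord₂ (embed₁ a) = 0 ∧ coord₂ (embed₂ a) = a ∧ coord₂ (embed₃ a) = 0) ∧
    (coord₃ (embed₁ a) = 0 ∧ coord₃ (embed₂ a) = 0 ∧ coord₃ (embed₃ a) = a) := by
  have h := sqrt_two_inv_mul_self
  have hI := Complex.I_mul_I
  set s := (Real.sqrt 2 : ℂ)⁻¹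
  simp only [coord₁_apply, coord₂_apply, coord₃_apply, embed₁, embed₂, embed₃,
    ContinuousLinearMap.smulRight_apply, one_apply_eq_self, PiLp.smul_apply, smul_eq_mul]
  refine ⟨⟨?_, ?_, ?_⟩, ⟨?_, ?_, ?_⟩, ?_, ?_, ?_⟩ <;> simp <;> grind

theorem embed_coord (u : C3) : embed₁ (coord₁ u) + embed₂ (coord₂ u) + embed₃ (coord₃ u) = u := by
  have h := sqrt_two_inv_mul_self
  have hI := Complex.I_mul_I
  set s := (Real.sqrt 2 : ℂ)⁻¹ with hs
  ext i
  simp only [coord₁_apply, coord₂_apply, coord₃_apply, embed₁, embed₂, embed₃, PiLp.add_apply,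
    ContinuousLinearMap.smulRight_apply, one_apply_eq_self, PiLp.smul_apply, smul_eq_mul]
  fin_cases i <;> simp [← hs] <;> grind

theorem eq_of_coord_eq {u v : C3} (h₁ : coord₁ u = coord₁ v) (h₂ : coord₂ u = coord₂ v)
    (h₃ : coord₃ u = coord₃ v) : u = v := by
  rw [← embed_coord u, h₁, h₂, h₃, embed_coord]

theorem crossMap_apply (b : Fin 3 → ℝ) (u : C3) :
    crossMap b u 0 = b 1 * u 2 - b 2 * u 1 ∧ crossMap b u 1 = b 2 * u 0 - b 0 * u 2 ∧
      crossMap b u 2 = b 0 * u 1 - b 1 * u 0 := by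
  refine ⟨?_, ?_, ?_⟩ <;> simp [crossMap, cross_apply]

section

variable (b₁ b₂ b₃ : Space k → ℝ) (x : Space k) (u : C3)

theorem coord₁_crossMap : coord₁ (crossMap ![b₁ x, b₂ x, b₃ x] u) =
    Complex.I * b₃ x * coord₁ u - Complex.I * cField b₁ b₂ x * coord₃ u := by
  obtain ⟨h0, h1, -⟩ := crossMap_apply ![b₁ x, b₂ x, b₃ x] u
  have hI := Complex.I_mul_I
  rw [coord₁_apply, coord₁_apply, coord₃_apply, h0, h1, cField, div_eq_mul_inv]
  simp only [Matrix.cons_val]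
  grind

theorem conj_cField : starRingEnd ℂ (cField b₁ b₂ x) =
    (b₁ x - Complex.I * b₂ x) * (Real.sqrt 2 : ℂ)⁻¹ := by
  rw [cField, div_eq_mul_inv]
  simp [sub_eq_add_neg]

theorem coord₂_crossMap : coord₂ (crossMap ![b₁ x, b₂ x, b₃ x] u) =
    -(Complex.I * b₃ x) * coord₂ u + Complex.I * starRingEnd ℂ (cField b₁ b₂ x) * coord₃ u := by
  obtain ⟨h0, h1, -⟩ := crossMap_apply ![b₁ x, b₂ x, b₃ x] u
  have hI := Complex.I_mul_I
  rw [coord₂_apply, coord₂_apply, coord₃_apply, h0, h1, conj_cField]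
  simp only [Matrix.cons_val]
  grind

theorem coord₃_crossMap : coord₃ (crossMap ![b₁ x, b₂ x, b₃ x] u) =
    -(Complex.I * starRingEnd ℂ (cField b₁ b₂ x)) * coord₁ u +
      Complex.I * cField b₁ b₂ x * coord₂ u := by
  obtain ⟨-, -, h2⟩ := crossMap_apply ![b₁ x, b₂ x, b₃ x] u
  have hI := Complex.I_mul_I
  have h := sqrt_two_inv_mul_self
  rw [coord₁_apply, coord₂_apply, coord₃_apply, h2, conj_cField, cField, div_eq_mul_inv]
  simp only [Matrix.cons_val]
  grind

end

end BlochTorrey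
end

noncomputable section

namespace BlochTorrey

open Filter Topology

variable {k : ℕ}

/-! ### `-Δ + b ×` as a coupled system -/

theorem coeFn_compLpL {F G : Type*} [NormedAddCommGroup F] [NormedSpace ℂ F]
    [NormedAddCommGroup G] [NormedSpace ℂ G] (L : F →L[ℂ] G) (f : L2 k F) :
    L.compLpL 2 volume f =ᵐ[volume] fun x => L (f x) :=
  L.coeFn_compLpL f

theorem contDiff_clm_comp {F G : Type*} [NormedAddCommGroup F] [NormedSpace ℂ F]
    [NormedSpace ℝ F] [IsScalarTower ℝ ℂ F]
    [NormedAddCommGroup G] [NormedSpace ℂ G] [NormedSpace ℝ G] [IsScalarTower ℝ ℂ G]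
    (L : F →L[ℂ] G) {u : Space k → F} (hu : ContDiff ℝ ∞ u) : ContDiff ℝ ∞ fun x => L (u x) :=
  (L.restrictScalars ℝ).contDiff.comp hu

theorem laplacian_clm_comp {F G : Type*} [NormedAddCommGroup F] [NormedSpace ℂ F]
    [NormedSpace ℝ F] [IsScalarTower ℝ ℂ F]
    [NormedAddCommGroup G] [NormedSpace ℂ G] [NormedSpace ℝ G] [IsScalarTower ℝ ℂ G]
    (L : F →L[ℂ] G) {u : Space k → F} (hu : ContDiff ℝ ∞ u) (x : Space k) :
    Δ (fun x => L (u x)) x = L (Δ u x) :=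
  (hu.contDiffAt.of_le two_le_smooth).laplacian_CLM_comp_left (l := L.restrictScalars ℝ)

/-- The components of an `L²` field in the basis that diagonalizes `u ↦ e₃ × u`. -/
def comp₁ (k : ℕ) : L2 k C3 →L[ℂ] L2 k ℂ := coord₁.compLpL 2 volume

def comp₂ (k : ℕ) : L2 k C3 →L[ℂ] L2 k ℂ := coord₂.compLpL 2 volume

def comp₃ (k : ℕ) : L2 k C3 →L[ℂ] L2 k ℂ := coord₃.compLpL 2 volume

/-- The `L²` field with the given component in the basis that diagonalizes `u ↦ e₃ × u`. -/
def field₁ (k : ℕ) : L2 k ℂ →L[ℂ] L2 k C3 := embed₁.compLpL 2 volume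

def field₂ (k : ℕ) : L2 k ℂ →L[ℂ] L2 k C3 := embed₂.compLpL 2 volume

def field₃ (k : ℕ) : L2 k ℂ →L[ℂ] L2 k C3 := embed₃.compLpL 2 volume

theorem compLpL_compLpL_eq_self {L : ℂ →L[ℂ] C3} {M : C3 →L[ℂ] ℂ} (h : ∀ a, M (L a) = a)
    (f : L2 k ℂ) : M.compLpL 2 volume (L.compLpL 2 volume f) = f := by
  refine Lp.ext ?_
  filter_upwards [coeFn_compLpL M (L.compLpL 2 volume f), coeFn_compLpL L f] with x h1 h2
  rw [h1, h2, h]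

theorem compLpL_compLpL_eq_zero {L : ℂ →L[ℂ] C3} {M : C3 →L[ℂ] ℂ} (h : ∀ a, M (L a) = 0)
    (f : L2 k ℂ) : M.compLpL 2 volume (L.compLpL 2 volume f) = 0 := by
  refine Lp.ext ?_
  filter_upwards [coeFn_compLpL M (L.compLpL 2 volume f), coeFn_compLpL L f,
    Lp.coeFn_zero ℂ 2 (volume : Measure (Space k))] with x h1 h2 h3
  rw [h1, h2, h, h3, Pi.zero_apply]

theorem sum_field_comp (u : L2 k C3) :
    field₁ k (comp₁ k u) + field₂ k (comp₂ k u) + field₃ k (comp₃ k u) = u := by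
  refine Lp.ext ?_
  filter_upwards [Lp.coeFn_add (field₁ k (comp₁ k u) + field₂ k (comp₂ k u)) (field₃ k (comp₃ k u)),
    Lp.coeFn_add (field₁ k (comp₁ k u)) (field₂ k (comp₂ k u)),
    coeFn_compLpL embed₁ (comp₁ k u), coeFn_compLpL embed₂ (comp₂ k u),
    coeFn_compLpL embed₃ (comp₃ k u), coeFn_compLpL coord₁ u, coeFn_compLpL coord₂ u,
    coeFn_compLpL coord₃ u] with x h1 h2 h3 h4 h5 h6 h7 h8
  rw [h1, Pi.add_apply, h2, Pi.add_apply]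
  simp only [field₁, field₂, field₃]
  rw [h3, h4, h5]
  simp only [comp₁, comp₂, comp₃]
  rw [h6, h7, h8, embed_coord]

section

variable {b₁ b₂ : Space k → ℝ} (h₁ : MemLp b₁ ∞ volume) (h₂ : MemLp b₂ ∞ volume)
  (b₃ : Space k → ℝ)

/-- Multiplication by `c`. -/
def mulC : L2 k ℂ →L[ℂ] L2 k ℂ := mulOp (cField b₁ b₂) (memLp_cField h₁ h₂)

/-- Multiplication by `c̄`. -/
def mulCbar : L2 k ℂ →L[ℂ] L2 k ℂ :=
  mulOp (fun x => starRingEnd ℂ (cField b₁ b₂ x)) (memLp_conj_cField h₁ h₂)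

theorem coeFn_add_smul_mulOp (a : ℂ) (f g : L2 k ℂ) (c : Space k → ℂ) (hc : MemLp c ∞ volume) :
    (f + a • mulOp c hc g : L2 k ℂ) =ᵐ[volume] fun x => f x + a * (c x * g x) := by
  filter_upwards [Lp.coeFn_add f (a • mulOp c hc g), Lp.coeFn_smul a (mulOp c hc g),
    coeFn_mulOp c hc g] with x e1 e2 e3
  rw [e1, Pi.add_apply, e2, Pi.smul_apply, e3, smul_eq_mul]

/-- The potential of `-Δ + i b₃`. -/
def potPlus (x : Space k) : ℂ →ₗ[ℂ] ℂ := LinearMap.mulLeft ℂ (Complex.I * b₃ x)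

/-- The potential of `-Δ - i b₃`. -/
def potMinus (x : Space k) : ℂ →ₗ[ℂ] ℂ := LinearMap.mulLeft ℂ (-(Complex.I * b₃ x))

/-- The potential of `-Δ`. -/
def potZero (_ : Space k) : ℂ →ₗ[ℂ] ℂ := LinearMap.mulLeft ℂ 0

/-- A constant change of basis preserves test functions and commutes with `Δ`; the off-diagonal
potential terms are moved to the side of `g`. -/
theorem mem_testGraph_iff (u g : L2 k C3) :
    (u, g) ∈ testGraph (fun x => crossMap ![b₁ x, b₂ x, b₃ x]) ↔
      (comp₁ k u, comp₁ k g + Complex.I • mulC h₁ h₂ (comp₃ k u)) ∈ testGraph (potPlus b₃) ∧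
      (comp₂ k u, comp₂ k g + (-Complex.I) • mulCbar h₁ h₂ (comp₃ k u)) ∈ testGraph (potMinus b₃) ∧
      (comp₃ k u, comp₃ k g + Complex.I • mulCbar h₁ h₂ (comp₁ k u) +
        (-Complex.I) • mulC h₁ h₂ (comp₂ k u)) ∈ testGraph (potZero (k := k)) := by
  have m1 := coeFn_add_smul_mulOp Complex.I (comp₁ k g) (comp₃ k u) _ (memLp_cField h₁ h₂)
  have m2 := coeFn_add_smul_mulOp (-Complex.I) (comp₂ k g) (comp₃ k u) _ (memLp_conj_cField h₁ h₂)
  have m3 := coeFn_add_smul_mulOp Complex.I (comp₃ k g) (comp₁ k u) _ (memLp_conj_cField h₁ h₂)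
  have m4 := coeFn_add_smul_mulOp (-Complex.I) (comp₃ k g + Complex.I • mulCbar h₁ h₂ (comp₁ k u))
    (comp₂ k u) _ (memLp_cField h₁ h₂)
  have u1 : comp₁ k u =ᵐ[volume] fun x => coord₁ (u x) := coeFn_compLpL coord₁ u
  have u2 : comp₂ k u =ᵐ[volume] fun x => coord₂ (u x) := coeFn_compLpL coord₂ u
  have u3 : comp₃ k u =ᵐ[volume] fun x => coord₃ (u x) := coeFn_compLpL coord₃ u
  have g1 : comp₁ k g =ᵐ[volume] fun x => coord₁ (g x) := coeFn_compLpL coord₁ g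
  have g2 : comp₂ k g =ᵐ[volume] fun x => coord₂ (g x) := coeFn_compLpL coord₂ g
  have g3 : comp₃ k g =ᵐ[volume] fun x => coord₃ (g x) := coeFn_compLpL coord₃ g
  constructor
  · rintro ⟨v, hv, hv', e1, e2⟩
    simp only at e1 e2
    refine ⟨⟨fun x => coord₁ (v x), contDiff_clm_comp _ hv, hv'.comp_left (map_zero _), ?_, ?_⟩,
      ⟨fun x => coord₂ (v x), contDiff_clm_comp _ hv, hv'.comp_left (map_zero _), ?_, ?_⟩,
      ⟨fun x => coord₃ (v x), contDiff_clm_comp _ hv, hv'.comp_left (map_zero _), ?_, ?_⟩⟩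
    · filter_upwards [u1, e1] with x u1 e1 using u1.trans (by rw [e1])
    · filter_upwards [m1, u3, g1, e1, e2] with x m1 u3 g1 e1 e2
      refine m1.trans ?_
      simp only [g1, u3, e1, e2]
      rw [laplacian_clm_comp _ hv, map_add, map_neg, coord₁_crossMap, potPlus,
        LinearMap.mulLeft_apply]
      ring
    · filter_upwards [u2, e1] with x u2 e1 using u2.trans (by rw [e1])
    · filter_upwards [m2, u3, g2, e1, e2] with x m2 u3 g2 e1 e2
      refine m2.trans ?_
      simp only [g2, u3, e1, e2]
      rw [laplacian_clm_comp _ hv, map_add, map_neg, coord₂_crossMap, potMinus,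
        LinearMap.mulLeft_apply]
      ring
    · filter_upwards [u3, e1] with x u3 e1 using u3.trans (by rw [e1])
    · filter_upwards [m4, m3, u1, u2, g3, e1, e2] with x m4 m3 u1 u2 g3 e1 e2
      refine m4.trans ?_
      refine (congrArg (· + _) m3).trans ?_
      simp only [g3, u1, u2, e1, e2]
      rw [laplacian_clm_comp _ hv, map_add, map_neg, coord₃_crossMap, potZero,
        LinearMap.mulLeft_apply]
      ring
  · rintro ⟨⟨v₁, hv₁, hv₁', e1, f1⟩, ⟨v₂, hv₂, hv₂', e2, f2⟩, ⟨v₃, hv₃, hv₃', e3, f3⟩⟩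
    simp only at e1 f1 e2 f2 e3 f3
    set v : Space k → C3 := fun x => embed₁ (v₁ x) + embed₂ (v₂ x) + embed₃ (v₃ x) with hvdef
    have hv : ContDiff ℝ ∞ v :=
      ((contDiff_clm_comp _ hv₁).add (contDiff_clm_comp _ hv₂)).add (contDiff_clm_comp _ hv₃)
    have hv' : HasCompactSupport v :=
      ((hv₁'.comp_left (map_zero embed₁)).add (hv₂'.comp_left (map_zero embed₂))).add
        (hv₃'.comp_left (map_zero embed₃))
    have c1 : (fun x => coord₁ (v x)) = v₁ := by
      ext x
      simp only [hvdef, map_add, coord_embed, add_zero]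
    have c2 : (fun x => coord₂ (v x)) = v₂ := by
      ext x
      simp only [hvdef, map_add, coord_embed, add_zero, zero_add]
    have c3 : (fun x => coord₃ (v x)) = v₃ := by
      ext x
      simp only [hvdef, map_add, coord_embed, zero_add]
    refine ⟨v, hv, hv', ?_, ?_⟩
    · filter_upwards [e1, e2, e3, u1, u2, u3] with x e1 e2 e3 u1 u2 u3
      refine eq_of_coord_eq ?_ ?_ ?_
      · exact (u1.symm.trans e1).trans (congrFun c1 x).symm
      · exact (u2.symm.trans e2).trans (congrFun c2 x).symm
      · exact (u3.symm.trans e3).trans (congrFun c3 x).symm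
    · filter_upwards [e1, e2, e3, f1, f2, f3, m1, m2, m3, m4, g1, g2, g3] with
        x e1 e2 e3 f1 f2 f3 m1 m2 m3 m4 g1 g2 g3
      have d1 : coord₁ (v x) = v₁ x := congrFun c1 x
      have d2 : coord₂ (v x) = v₂ x := congrFun c2 x
      have d3 : coord₃ (v x) = v₃ x := congrFun c3 x
      have l1 := laplacian_clm_comp coord₁ hv x
      have l2 := laplacian_clm_comp coord₂ hv x
      have l3 := laplacian_clm_comp coord₃ hv x
      rw [c1] at l1
      rw [c2] at l2
      rw [c3] at l3
      have n1 := m1.symm.trans f1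
      have n2 := m2.symm.trans f2
      have n3 := ((congrArg (· + _) m3).symm.trans (m4.symm.trans f3))
      simp only [e1, e2, e3] at n1 n2 n3
      rw [potPlus, LinearMap.mulLeft_apply] at n1
      rw [potMinus, LinearMap.mulLeft_apply] at n2
      rw [potZero, LinearMap.mulLeft_apply] at n3
      refine eq_of_coord_eq ?_ ?_ ?_
      · rw [← g1, map_add, map_neg, coord₁_crossMap, ← l1, d1, d3]
        linear_combination n1
      · rw [← g2, map_add, map_neg, coord₂_crossMap, ← l2, d2, d3]
        linear_combination n2
      · rw [← g3, map_add, map_neg, coord₃_crossMap, ← l3, d1, d2]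
        linear_combination n3

end

end BlochTorrey
end

/-! ### Passing to closures, and the main theorem -/

noncomputable section

namespace BlochTorrey

open Filter Topology

variable {k : ℕ} {b₁ b₂ : Space k → ℝ} (h₁ : MemLp b₁ ∞ volume) (h₂ : MemLp b₂ ∞ volume)
  (b₃ : Space k → ℝ)

theorem mem_closure_testGraph_iff (u g : L2 k C3) :
    (u, g) ∈ closure (testGraph (fun x => crossMap ![b₁ x, b₂ x, b₃ x]) :
        Set (L2 k C3 × L2 k C3)) ↔
      (comp₁ k u, comp₁ k g + Complex.I • mulC h₁ h₂ (comp₃ k u)) ∈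
        closure (testGraph (potPlus b₃) : Set (L2 k ℂ × L2 k ℂ)) ∧
      (comp₂ k u, comp₂ k g + (-Complex.I) • mulCbar h₁ h₂ (comp₃ k u)) ∈
        closure (testGraph (potMinus b₃) : Set (L2 k ℂ × L2 k ℂ)) ∧
      (comp₃ k u, comp₃ k g + Complex.I • mulCbar h₁ h₂ (comp₁ k u) +
        (-Complex.I) • mulC h₁ h₂ (comp₂ k u)) ∈
        closure (testGraph (potZero (k := k)) : Set (L2 k ℂ × L2 k ℂ)) := by
  constructor
  · intro h
    have c1 : Continuous fun p : L2 k C3 × L2 k C3 =>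
      (comp₁ k p.1, comp₁ k p.2 + Complex.I • mulC h₁ h₂ (comp₃ k p.1)) := by fun_prop
    have c2 : Continuous fun p : L2 k C3 × L2 k C3 =>
      (comp₂ k p.1, comp₂ k p.2 + (-Complex.I) • mulCbar h₁ h₂ (comp₃ k p.1)) := by fun_prop
    have c3 : Continuous fun p : L2 k C3 × L2 k C3 =>
      (comp₃ k p.1, comp₃ k p.2 + Complex.I • mulCbar h₁ h₂ (comp₁ k p.1) +
        (-Complex.I) • mulC h₁ h₂ (comp₂ k p.1)) := by fun_prop
    have m1 := map_mem_closure (t := (testGraph (potPlus b₃) : Set (L2 k ℂ × L2 k ℂ))) c1 h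
      fun p hp => ((mem_testGraph_iff h₁ h₂ b₃ p.1 p.2).1 hp).1
    have m2 := map_mem_closure (t := (testGraph (potMinus b₃) : Set (L2 k ℂ × L2 k ℂ))) c2 h
      fun p hp => ((mem_testGraph_iff h₁ h₂ b₃ p.1 p.2).1 hp).2.1
    have m3 := map_mem_closure (t := (testGraph (potZero (k := k)) : Set (L2 k ℂ × L2 k ℂ))) c3 h
      fun p hp => ((mem_testGraph_iff h₁ h₂ b₃ p.1 p.2).1 hp).2.2
    exact ⟨m1, m2, m3⟩
  · rintro ⟨H1, H2, H3⟩
    -- The inverse of the change of variables on graphs. It is continuous because the couplings are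
    -- bounded, so it carries the product of the three closures into the closure.
    set Ψ : (L2 k ℂ × L2 k ℂ) × (L2 k ℂ × L2 k ℂ) × (L2 k ℂ × L2 k ℂ) → L2 k C3 × L2 k C3 :=
      fun q => (field₁ k q.1.1 + field₂ k q.2.1.1 + field₃ k q.2.2.1,
        field₁ k (q.1.2 - Complex.I • mulC h₁ h₂ q.2.2.1) +
          field₂ k (q.2.1.2 - (-Complex.I) • mulCbar h₁ h₂ q.2.2.1) +
          field₃ k (q.2.2.2 - (-Complex.I) • mulC h₁ h₂ q.2.1.1 -
            Complex.I • mulCbar h₁ h₂ q.1.1)) with hΨ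
    have hc : Continuous Ψ := by
      rw [hΨ]
      fun_prop
    have hmem := Set.mk_mem_prod H1 (Set.mk_mem_prod H2 H3)
    rw [← closure_prod_eq, ← closure_prod_eq] at hmem
    have h := map_mem_closure (t := (testGraph (fun x => crossMap ![b₁ x, b₂ x, b₃ x]) :
        Set (L2 k C3 × L2 k C3))) hc hmem ?_
    · simp only [hΨ, add_sub_cancel_right, sum_field_comp] at h
      exact h
    · rintro ⟨⟨a, a'⟩, ⟨b, b'⟩, ⟨c, c'⟩⟩ ⟨ha, hb, hc⟩
      have s1 : ∀ x y w, comp₁ k (field₁ k x + field₂ k y + field₃ k w) = x := fun x y w => by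
        rw [map_add, map_add, comp₁, field₁, field₂, field₃,
          compLpL_compLpL_eq_self fun a => (coord_embed a).1.1,
          compLpL_compLpL_eq_zero fun a => (coord_embed a).1.2.1,
          compLpL_compLpL_eq_zero fun a => (coord_embed a).1.2.2, add_zero, add_zero]
      have s2 : ∀ x y w, comp₂ k (field₁ k x + field₂ k y + field₃ k w) = y := fun x y w => by
        rw [map_add, map_add, comp₂, field₁, field₂, field₃,
          compLpL_compLpL_eq_zero fun a => (coord_embed a).2.1.1,
          compLpL_compLpL_eq_self fun a => (coord_embed a).2.1.2.1,
          compLpL_compLpL_eq_zero fun a => (coord_embed a).2.1.2.2, add_zero, zero_add]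
      have s3 : ∀ x y w, comp₃ k (field₁ k x + field₂ k y + field₃ k w) = w := fun x y w => by
        rw [map_add, map_add, comp₃, field₁, field₂, field₃,
          compLpL_compLpL_eq_zero fun a => (coord_embed a).2.2.1,
          compLpL_compLpL_eq_zero fun a => (coord_embed a).2.2.2.1,
          compLpL_compLpL_eq_self fun a => (coord_embed a).2.2.2.2, add_zero, zero_add]
      simp only [hΨ]
      refine (mem_testGraph_iff h₁ h₂ b₃ _ _).2 ?_
      simp only [s1, s2, s3, sub_add_cancel]
      exact ⟨ha, hb, hc⟩

theorem graph_schrodinger {F : Type*} [NormedAddCommGroup F] [NormedSpace ℝ F] [NormedSpace ℂ F]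
    {V : Space k → F →ₗ[ℂ] F} (h : (testGraph V).toLinearPMap.IsClosable) (u g : L2 k F) :
    (u, g) ∈ (schrodinger V).graph ↔ (u, g) ∈ closure (testGraph V : Set (L2 k F × L2 k F)) := by
  rw [schrodinger, ← h.graph_closure_eq_closure_graph, graph_testGraph]
  rfl

theorem isClosable_of_nonempty {F : Type*} [NormedAddCommGroup F] [NormedSpace ℝ F]
    [NormedSpace ℂ F] {V : Space k → F →ₗ[ℂ] F} (h : (schrodinger V).resolventSet.Nonempty) :
    (testGraph V).toLinearPMap.IsClosable :=
  LinearPMap.isClosable_of_mem_resolventSet_closure h.some_mem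

theorem eq_zero_of_mem_closure {F : Type*} [NormedAddCommGroup F] [NormedSpace ℝ F]
    [NormedSpace ℂ F] {V : Space k → F →ₗ[ℂ] F} (h : (testGraph V).toLinearPMap.IsClosable)
    {g : L2 k F} (hg : (0, g) ∈ closure (testGraph V : Set (L2 k F × L2 k F))) : g = 0 :=
  (schrodinger V).graph_fst_eq_zero_snd ((graph_schrodinger h 0 g).2 hg) rfl

theorem nonempty_resolventSet_free : (schrodinger (potZero (k := k))).resolventSet.Nonempty := by
  refine ⟨-1, mem_resolventSet_free ?_⟩
  rintro ⟨x, hx, hx'⟩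
  have h := congrArg Complex.re hx'
  simp only [Complex.ofReal_re, Complex.neg_re, Complex.one_re] at h
  have hx0 : (0 : ℝ) ≤ x := hx
  linarith

/-- Over `u = 0` the couplings vanish, so the components of `g` lie over 0 in the closures of three
closable graphs. -/
theorem isClosable_blochTorrey {b₁ b₂ : Space k → ℝ} (h₁ : MemLp b₁ ∞ volume)
    (h₂ : MemLp b₂ ∞ volume) (b₃ : Space k → ℝ) (hp : (opPlus b₃).resolventSet.Nonempty)
    (hm : (opMinus b₃).resolventSet.Nonempty) :
    (testGraph (fun x => crossMap ![b₁ x, b₂ x, b₃ x])).toLinearPMap.IsClosable := by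
  refine ⟨(testGraph (fun x => crossMap ![b₁ x, b₂ x, b₃ x])).topologicalClosure.toLinearPMap, ?_⟩
  rw [graph_testGraph, Submodule.toLinearPMap_graph_eq]
  rintro ⟨u, g⟩ h h0
  simp only at h0 ⊢
  subst h0
  obtain ⟨H1, H2, H3⟩ := (mem_closure_testGraph_iff h₁ h₂ b₃ 0 g).1 h
  simp only [map_zero, smul_zero, add_zero] at H1 H2 H3
  have e1 := eq_zero_of_mem_closure (isClosable_of_nonempty hp) H1
  have e2 := eq_zero_of_mem_closure (isClosable_of_nonempty hm) H2
  have e3 := eq_zero_of_mem_closure (isClosable_of_nonempty nonempty_resolventSet_free) H3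
  rw [← sum_field_comp g, e1, e2, e3]
  simp

/-- `-Δ + b ×` in the basis that diagonalizes `u ↦ e₃ × u`. -/
def coupledSystem (hp : (opPlus b₃).resolventSet.Nonempty)
    (hm : (opMinus b₃).resolventSet.Nonempty) : CoupledSystem (L2 k C3) (L2 k ℂ) where
  p₁ := comp₁ k
  p₂ := comp₂ k
  p₃ := comp₃ k
  i₁ := field₁ k
  i₂ := field₂ k
  i₃ := field₃ k
  b₁₃ := -(Complex.I • mulC h₁ h₂)
  b₂₃ := Complex.I • mulCbar h₁ h₂
  b₃₁ := -(Complex.I • mulCbar h₁ h₂)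
  b₃₂ := Complex.I • mulC h₁ h₂
  T₁ := opPlus b₃
  T₂ := opMinus b₃
  T₃ := scalarOp fun _ => 0
  A := blochTorrey b₁ b₂ b₃
  p₁_i₁ := compLpL_compLpL_eq_self fun a => (coord_embed a).1.1
  p₁_i₂ := compLpL_compLpL_eq_zero fun a => (coord_embed a).1.2.1
  p₁_i₃ := compLpL_compLpL_eq_zero fun a => (coord_embed a).1.2.2
  p₂_i₁ := compLpL_compLpL_eq_zero fun a => (coord_embed a).2.1.1
  p₂_i₂ := compLpL_compLpL_eq_self fun a => (coord_embed a).2.1.2.1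
  p₂_i₃ := compLpL_compLpL_eq_zero fun a => (coord_embed a).2.1.2.2
  p₃_i₁ := compLpL_compLpL_eq_zero fun a => (coord_embed a).2.2.1
  p₃_i₂ := compLpL_compLpL_eq_zero fun a => (coord_embed a).2.2.2.1
  p₃_i₃ := compLpL_compLpL_eq_self fun a => (coord_embed a).2.2.2.2
  sum_i_p := sum_field_comp
  graph_iff := fun u g => by
    have h := graph_schrodinger (isClosable_blochTorrey h₁ h₂ b₃ hp hm) u g
    rw [mem_closure_testGraph_iff h₁ h₂ b₃, ← graph_schrodinger (V := potPlus b₃) (isClosable_of_nonempty hp),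
      ← graph_schrodinger (V := potMinus b₃) (isClosable_of_nonempty hm),
      ← graph_schrodinger (isClosable_of_nonempty nonempty_resolventSet_free)] at h
    refine h.trans ?_
    simp only [neg_apply, smul_apply, sub_neg_eq_add, neg_smul, ← sub_eq_add_neg]
    rfl

/-- Each path through the system collects two factors `±i` of equal sign, with product `-1`, which
cancels the minus sign in `feedback`. -/
theorem schurK_eq (hp : (opPlus b₃).resolventSet.Nonempty)
    (hm : (opMinus b₃).resolventSet.Nonempty) (z : ℂ) :
    schurK h₁ h₂ b₃ z = (scalarOp fun _ => 0).resolvent z *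
      (coupledSystem h₁ h₂ b₃ hp hm).feedback ((opPlus b₃).resolvent z)
        ((opMinus b₃).resolvent z) := by
  ext1 f
  change (scalarOp fun _ => 0).resolvent z
      (mulC h₁ h₂ ((opMinus b₃).resolvent z (mulCbar h₁ h₂ f)) +
        mulCbar h₁ h₂ ((opPlus b₃).resolvent z (mulC h₁ h₂ f))) =
    (scalarOp fun _ => 0).resolvent z
      (-(-(Complex.I • mulCbar h₁ h₂ ((opPlus b₃).resolvent z (-(Complex.I • mulC h₁ h₂ f)))) +
        Complex.I • mulC h₁ h₂ ((opMinus b₃).resolvent z (Complex.I • mulCbar h₁ h₂ f))))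
  congr 1
  simp only [map_neg, map_smul, smul_neg, smul_smul, Complex.I_mul_I]
  module

end BlochTorrey
end

open BlochTorrey

theorem mainTheorem9 (k r : ℕ) (b₁ b₂ b₃ : Space k → ℝ)
    (hb₁ : MemLp b₁ ∞ volume) (hb₂ : MemLp b₂ ∞ volume)
    (hb₃ : ContDiff ℝ ((r + 1 : ℕ) : ℕ∞) b₃)
    (C₀ : ℝ) (hgrowth : GrowthCondition r C₀ b₃) :
    (∀ z ∈ Omega b₃,
      (z ∈ (blochTorrey b₁ b₂ b₃).spectrum ↔ (-1 : ℂ) ∈ spectrum ℂ (schurK hb₁ hb₂ b₃ z))) ∧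
    ((opPlus b₃).HasCompactResolvent → (opMinus b₃).HasCompactResolvent →
      ∀ z ∈ Omega b₃, z ∈ (blochTorrey b₁ b₂ b₃).spectrum →
        (blochTorrey b₁ b₂ b₃).IsIsolatedEigenvalueOfFiniteMultiplicity z) := by
  have hΩ : ∀ {z : ℂ}, z ∈ Omega b₃ → z ∈ (Complex.ofReal '' Set.Ici 0)ᶜ ∧
      z ∈ (opPlus b₃).resolventSet ∧ z ∈ (opMinus b₃).resolventSet := fun {z} hz =>
    ⟨fun h => hz (.inl (.inl h)), not_not.1 fun h => hz (.inl (.inr h)),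
      not_not.1 fun h => hz (.inr h)⟩
  refine ⟨fun z hz => ?_, fun hp hm z hz hzA => ?_⟩
  · obtain ⟨h0, hp, hm⟩ := hΩ hz
    have h := (coupledSystem hb₁ hb₂ b₃ ⟨z, hp⟩ ⟨z, hm⟩).mem_resolventSet_iff
      (LinearPMap.resolvent_spec hp) (LinearPMap.resolvent_spec hm)
      (LinearPMap.resolvent_spec (mem_resolventSet_free h0))
    -- Here `-1 - K = -(1 + K)`, so the spectral condition says that the Schur complement is not a
    -- unit.
    rw [spectrum.mem_iff, schurK_eq hb₁ hb₂ b₃ ⟨z, hp⟩ ⟨z, hm⟩, map_neg, map_one, ← neg_add',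
      IsUnit.neg_iff]
    exact not_congr h
  · obtain ⟨h0, hp', hm'⟩ := hΩ hz
    refine (coupledSystem hb₁ hb₂ b₃ ⟨z, hp'⟩
      ⟨z, hm'⟩).isIsolatedEigenvalueOfFiniteMultiplicity ?_ ?_ ?_ hp hm
        (fun w hw => mem_resolventSet_free hw) h0 hzA
    · exact fun v g h => re_inner_nonneg_of_mem_graph (fun x => by simp) v g h
    · exact fun v g h => re_inner_nonneg_of_mem_graph (fun x => by simp) v g h
    · exact fun v g h => re_inner_nonneg_of_mem_graph (fun x => by simp) v g h
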